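/- Let $r\ge 1$. An $r$-differential tower of groups is an infinite tower of finite groups $1=G_0\le G_1\le G_2\le\cdots$ such that the restriction of every irreducible complex character of $G_{n+1}$ to $G_n$ is multiplicity-free ($n\ge 0$) and, on the $\mathbb Z$-module of virtual characters of $G_n$, $$\mathrm{Res}^{G_{n+1}}_{G_n}\mathrm{Ind}^{G_{n+1}}_{G_n}-\mathrm{Ind}^{G_n}_{G_{n-1}}\mathrm{Res}^{G_n}_{G_{n-1}}=r\cdot\mathrm{id}\qquad(n\ge 0),$$ where the second term is absent for $n=0$. Its associated poset is graded, with $n$-th rank $P_n=\mathrm{Irr}(G_n)$, and with $\psi\in\mathrm{Irr}(G_{n+1})$ covering $\chi\in\mathrm{Irr}(G_n)$ exactly when $\chi$ is a constituent of $\mathrm{Res}^{G_{n+1}}_{G_n}\psi$. Let $\mathbf Y^r$ be the $r$-fold Cartesian power of Young's lattice, ranked by the total number of boxes. For a graded poset $P$ with finite ranks $P_n$, put $p_n=|P_n|$. Let $U_n:\mathbb Z^{P_n}\to\mathbb Z^{P_{n+1}}$ send each basis element to the sum of the elements covering it, let $D_{n+1}:\mathbb Z^{P_{n+1}}\to\mathbb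 Z^{P_n}$ send each basis element to the sum of the elements it covers, and put $DU_n=D_{n+1}U_n$. A square integer matrix $A$ has last Smith invariant $s$ if there are integer matrices $S,T$, invertible over $\mathbb Z$, such that $SAT$ is diagonal with diagonal entries $s_1\mid s_2\mid\cdots\mid s_p=s$; this determines $s$ up to sign. Then for the poset $P$ associated to any $r$-differential tower of groups, and also for $P=\mathbf Y^r$: (i) $p_{n-1}<p_n$ for every $n\ge 2$; (ii) for every integer $n\ge 0$ and every integer $k$, the last Smith invariant of $DU_n+kI$ is $0$ if $DU_n+kI$ is singular, and is, up to sign, the product of the distinct eigenvalues of $DU_n+kI$ if it is nonsingular. -/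

import Mathlib

universe u

/-! ### Smith forms of square matrices -/

/-- `d` is the list of diagonal entries `s₁ ∣ s₂ ∣ ⋯` of a Smith form of the square matrix `A`
over `R`: for invertible `P`, `Q` the matrix `P * A * Q` is diagonal with entries `d`. Since the
index type `m` carries no order, its elements are enumerated by some bijection `e`. -/
def IsSmithDiagonal {R : Type*} [CommRing R] {m : Type*} [Fintype m] [DecidableEq m]
    (A : Matrix m m R) (d : Fin (Fintype.card m) → R) : Prop :=
  (∀ i j, i ≤ j → d i ∣ d j) ∧
    ∃ (e : m ≃ Fin (Fintype.card m)) (P Q : GL m R),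
      (P : Matrix m m R) * A * (Q : Matrix m m R) = Matrix.diagonal (fun x => d (e x))

/-- `s` is the last diagonal entry of a Smith form of `A` over `R`. (It is determined up to a unit
of `R`.) -/
def IsLastSmithInvariant {R : Type*} [CommRing R] {m : Type*} [Fintype m] [DecidableEq m]
    (A : Matrix m m R) (s : R) : Prop :=
  ∃ d : Fin (Fintype.card m) → R, IsSmithDiagonal A d ∧
    ∃ i : Fin (Fintype.card m), (i : ℕ) + 1 = Fintype.card m ∧ d i = s

/-- The product of the distinct complex eigenvalues of an integer square matrix. -/
noncomputable def prodDistinctEigenvalues {m : Type*} [Fintype m] [DecidableEq m]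
    (A : Matrix m m ℤ) : ℂ :=
  ∏ μ : Module.End.Eigenvalues (Matrix.toLin' (A.map (Int.cast : ℤ → ℂ))), (μ : ℂ)

/-! ### Graded posets and their up and down maps -/

namespace GradedPoset

variable (P : Type*) [PartialOrder P] [GradeOrder ℕ P]

/-- The `n`-th rank `P_n` of a graded poset. -/
def Rank (n : ℕ) : Type _ := {x : P // grade ℕ x = n}

noncomputable instance (n : ℕ) : DecidableEq (Rank P n) := Classical.decEq _

noncomputable instance (n : ℕ) [Finite (Rank P n)] : Fintype (Rank P n) := Fintype.ofFinite _

/-- The rank size `p_n`. -/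
noncomputable def rankSize (n : ℕ) : ℕ := Nat.card (Rank P n)

open Classical in
/-- The matrix of the up map `U_n : ℤ^{p_n} → ℤ^{p_{n+1}}`, sending a basis element to the sum of
all elements that cover it. -/
noncomputable def upMatrix (n : ℕ) : Matrix (Rank P (n + 1)) (Rank P n) ℤ :=
  Matrix.of fun y x => if x.1 ⋖ y.1 then 1 else 0

open Classical in
/-- The matrix of the down map `D_{n+1} : ℤ^{p_{n+1}} → ℤ^{p_n}`, sending a basis element to the
sum of all elements that it covers. -/
noncomputable def downMatrix (n : ℕ) : Matrix (Rank P n) (Rank P (n + 1)) ℤ :=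
  Matrix.of fun x y => if x.1 ⋖ y.1 then 1 else 0

variable [∀ n, Finite (Rank P n)]

/-- `DU_n = D_{n+1} U_n`. -/
noncomputable def DU (n : ℕ) : Matrix (Rank P n) (Rank P n) ℤ :=
  downMatrix P n * upMatrix P n

/-- `DU_n + k I`. -/
noncomputable def DUAdd (n : ℕ) (k : ℤ) : Matrix (Rank P n) (Rank P n) ℤ :=
  DU P n + k • (1 : Matrix (Rank P n) (Rank P n) ℤ)

end GradedPoset

/-! ### Characters of finite groups -/

/-- The set `Irr(G)` of irreducible complex characters of `G`: the characters of the irreducible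
finite-dimensional complex representations. -/
def Irr (G : Type*) [Group G] : Set (G → ℂ) :=
  {χ | ∃ (d : ℕ) (ρ : Representation ℂ G (Fin d → ℂ)), ρ.IsIrreducible ∧ χ = ρ.character}

/-- The `ℤ`-module of virtual characters: `ℤ`-linear combinations of irreducible characters. -/
def virtualCharacters (G : Type*) [Group G] : Submodule ℤ (G → ℂ) :=
  Submodule.span ℤ (Irr G)

/-- The pairing `⟨f, h⟩ = |G|⁻¹ ∑ f(g) h(g⁻¹)`. Since `h(g⁻¹)` is the complex conjugate of `h(g)`
for a (virtual) character `h`, it is the usual inner product on virtual characters, and for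
irreducible `h` the multiplicity of `h` in `f`. -/
noncomputable def charPairing {G : Type*} [Group G] [Fintype G] (f h : G → ℂ) : ℂ :=
  (Nat.card G : ℂ)⁻¹ * ∑ g : G, f g * h g⁻¹

/-- Restriction of functions along a homomorphism (the inclusion of a subgroup). -/
def resChar {H G : Type*} [Group H] [Group G] (ι : H →* G) (f : G → ℂ) : H → ℂ :=
  fun h => f (ι h)

open Classical in
/-- Induction of class functions along the inclusion `ι` of a subgroup:
`(Ind f)(g) = |H|⁻¹ ∑ f(x⁻¹ g x)`, summed over those `x ∈ G` for which `x⁻¹ g x` lies in `H`. -/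
noncomputable def indChar {H G : Type*} [Group H] [Group G] [Fintype H] [Fintype G]
    (ι : H →* G) (f : H → ℂ) : G → ℂ :=
  fun g => (Nat.card H : ℂ)⁻¹ * ∑ x : G, ∑ h : H, if x⁻¹ * g * x = ι h then f h else 0

/-- A finite group has finitely many irreducible characters. -/
instance irr_finite (G : Type*) [Group G] [Finite G] : Finite (Irr G) := by
  classical
  have : Fintype G := Fintype.ofFinite G
  let B : LinearMap.BilinForm ℂ (G → ℂ) := LinearMap.mk₂ ℂ
    (fun f h => (Nat.card G : ℂ)⁻¹ * ∑ g : G, f g * h g⁻¹)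
    (by intro a b c; simp [add_mul, Finset.sum_add_distrib, mul_add])
    (by intro a b c; simp [Finset.mul_sum]; congr 1; ext; ring)
    (by intro a b c; simp [mul_add, Finset.sum_add_distrib])
    (by intro a b c; simp [Finset.mul_sum]; congr 1; ext; ring)
  have : Invertible (Nat.card G : ℂ) :=
    invertibleOfNonzero (by exact_mod_cast Nat.card_pos.ne')
  have key : ∀ χ ψ : Irr G, B χ.1 ψ.1 = if χ = ψ then 1 else 0 := by
    rintro ⟨χ, d, ρ, hρ, rfl⟩ ⟨ψ, d', σ, hσ, rfl⟩
    have h := Representation.char_orthonormal ρ σ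
    change (Nat.card G : ℂ)⁻¹ * ∑ g : G, ρ.character g * σ.character g⁻¹ = _
    by_cases hE : Nonempty (Representation.Equiv σ ρ)
    · have : ρ.character = σ.character := (Representation.char_iso hE.some).symm
      simp only [this, if_true]
      simpa [hE, this] using h
    · rw [h, if_neg hE]
      split_ifs with h'
      · exfalso
        have h1 := Representation.char_orthonormal σ σ
        have e : ρ.character = σ.character := congrArg Subtype.val h'
        rw [if_neg hE, e, h1, if_pos ⟨Representation.Equiv.refl σ⟩] at h
        exact one_ne_zero h
      · rfl
  have hli : LinearIndependent ℂ (fun χ : Irr G => χ.1) := by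
    refine LinearMap.BilinForm.linearIndependent_of_iIsOrtho (B := B) ?_ ?_
    · intro χ ψ hne
      exact (key χ ψ).trans (if_neg hne)
    · intro χ h
      exact one_ne_zero (((key χ χ).trans (if_pos rfl)).symm.trans h)
  exact hli.finite

/-! ### Differential towers of groups -/

/-- An infinite tower `1 = G₀ ≤ G₁ ≤ G₂ ≤ ⋯` of finite groups; the inclusions are given as
injective homomorphisms `ι n : G n → G (n + 1)`. -/
structure GroupTower where
  G : ℕ → Type u
  [group : ∀ n, Group (G n)]
  [fintype : ∀ n, Fintype (G n)]
  ι : ∀ n, G n →* G (n + 1)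
  ι_injective : ∀ n, Function.Injective (ι n)
  subsingleton_zero : Subsingleton (G 0)

namespace GroupTower

attribute [instance] GroupTower.group GroupTower.fintype

/-- The multiplicity of `χ` in the restriction of `ψ` from `G_{n+1}` to `G_n`. -/
noncomputable def branching (T : GroupTower.{u}) (n : ℕ) (χ : T.G n → ℂ)
    (ψ : T.G (n + 1) → ℂ) : ℂ :=
  charPairing (resChar (T.ι n) ψ) χ

/-- The tower is `r`-differential: the restriction of irreducibles from `G_{n+1}` to `G_n` is
multiplicity-free and, on virtual characters of `G_n`,
`Res Ind - Ind Res = r · id`, where the second term is absent for `n = 0`. -/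
structure IsDifferential (T : GroupTower.{u}) (r : ℕ) : Prop where
  multiplicityFree : ∀ n, ∀ χ ∈ Irr (T.G n), ∀ ψ ∈ Irr (T.G (n + 1)),
    T.branching n χ ψ = 0 ∨ T.branching n χ ψ = 1
  res_ind_zero : ∀ f ∈ virtualCharacters (T.G 0),
    resChar (T.ι 0) (indChar (T.ι 0) f) = r • f
  res_ind_succ : ∀ n, ∀ f ∈ virtualCharacters (T.G (n + 1)),
    resChar (T.ι (n + 1)) (indChar (T.ι (n + 1)) f) - indChar (T.ι n) (resChar (T.ι n) f) = r • f

/-- The underlying set of the poset of the tower: all pairs of a rank `n` and an irreducible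
character of `G_n`. -/
def Poset (T : GroupTower.{u}) : Type u := Σ n : ℕ, Irr (T.G n)

/-- The branching relation between consecutive ranks: `χ ∈ Irr(G_n)` is a constituent of the
restriction of `ψ ∈ Irr(G_{n+1})`. -/
inductive Branch (T : GroupTower.{u}) : T.Poset → T.Poset → Prop
  | intro (n : ℕ) (χ : Irr (T.G n)) (ψ : Irr (T.G (n + 1))) (h : T.branching n χ.1 ψ.1 ≠ 0) :
      Branch T ⟨n, χ⟩ ⟨n + 1, ψ⟩

theorem Branch.fst_eq {T : GroupTower.{u}} {x y : T.Poset} (h : T.Branch x y) :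
    y.1 = x.1 + 1 := by
  cases h; rfl

theorem eq_or_fst_lt {T : GroupTower.{u}} {x y : T.Poset}
    (h : Relation.ReflTransGen T.Branch x y) : x = y ∨ x.1 < y.1 := by
  induction h with
  | refl => exact Or.inl rfl
  | tail _ h ih =>
    right
    have := h.fst_eq
    rcases ih with rfl | ih <;> omega

/-- The partial order on the poset of the tower generated by the branching relation, which
becomes its covering relation. -/
instance (T : GroupTower.{u}) : PartialOrder T.Poset where
  le := Relation.ReflTransGen T.Branch
  le_refl _ := Relation.ReflTransGen.refl
  le_trans _ _ _ := Relation.ReflTransGen.trans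
  le_antisymm x y h h' := by
    rcases eq_or_fst_lt h with h1 | h1
    · exact h1
    · rcases eq_or_fst_lt h' with h2 | h2
      · exact h2.symm
      · omega

instance (T : GroupTower.{u}) : GradeOrder ℕ T.Poset where
  grade x := x.1
  grade_strictMono x y h := (eq_or_fst_lt h.le).resolve_left h.ne
  covBy_grade x y h := by
    rcases Relation.ReflTransGen.cases_head (show Relation.ReflTransGen T.Branch x y from h.le) with
      h1 | ⟨c, h1, h2⟩
    · exact absurd h1 h.ne
    · have hxc : x < c := lt_of_le_of_ne (Relation.ReflTransGen.single h1) (by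
        rintro rfl; have := h1.fst_eq; omega)
      have hcy : c = y := by
        by_contra hne
        exact h.2 hxc (lt_of_le_of_ne h2 hne)
      subst hcy
      rw [h1.fst_eq]
      exact Order.covBy_add_one _

instance (T : GroupTower.{u}) (n : ℕ) : Finite (GradedPoset.Rank T.Poset n) := by
  refine Finite.of_surjective
    (fun χ : Irr (T.G n) => (⟨⟨n, χ⟩, rfl⟩ : GradedPoset.Rank T.Poset n)) ?_
  rintro ⟨⟨m, χ⟩, h⟩
  obtain rfl : m = n := h
  exact ⟨χ, rfl⟩

end GroupTower

/-! ### Cartesian powers of Young's lattice -/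

/-- The `r`-fold Cartesian power `Y^r` of Young's lattice, with the product order. -/
abbrev YoungPower (r : ℕ) : Type := Fin r → YoungDiagram

namespace YoungPower

theorem card_covBy {μ ν : YoungDiagram} (h : μ ⋖ ν) : ν.card = μ.card + 1 := by
  have hss : μ.cells ⊂ ν.cells := YoungDiagram.cells_ssubset_iff.2 h.1
  have hne : (ν.cells \ μ.cells).Nonempty := Finset.sdiff_nonempty.2 hss.2
  obtain ⟨c, hc⟩ := (ν.cells \ μ.cells).exists_minimal hne
  have hcm := Finset.mem_sdiff.1 hc.prop
  let κ : YoungDiagram :=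
    { cells := insert c μ.cells
      isLowerSet := by
        intro a b hba ha
        simp only [Finset.coe_insert, Set.mem_insert_iff, Finset.mem_coe] at ha ⊢
        rcases ha with rfl | ha
        · by_cases hb : b ∈ μ.cells
          · exact Or.inr hb
          · have hbν : b ∈ ν.cells := ν.isLowerSet hba hcm.1
            exact Or.inl (le_antisymm hba (hc.le_of_le (Finset.mem_sdiff.2 ⟨hbν, hb⟩) hba))
        · exact Or.inr (μ.isLowerSet hba ha) }
  have h1 : μ < κ := YoungDiagram.cells_ssubset_iff.1 (Finset.ssubset_insert hcm.2)
  have h2 : κ ≤ ν := YoungDiagram.cells_subset_iff.1 (Finset.insert_subset hcm.1 hss.1)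
  have h3 : κ = ν := by
    by_contra hne'
    exact h.2 h1 (lt_of_le_of_ne h2 hne')
  rw [← h3]
  exact Finset.card_insert_of_notMem hcm.2

/-- The rank of an `r`-tuple of Young diagrams is its total number of boxes. -/
noncomputable instance (r : ℕ) : GradeOrder ℕ (YoungPower r) where
  grade x := ∑ i, (x i).card
  grade_strictMono x y h := by
    obtain ⟨hle, i, hi⟩ := Pi.lt_def.1 h
    exact Finset.sum_lt_sum (fun j _ => Finset.card_le_card (YoungDiagram.cells_subset_iff.2 (hle j)))
      ⟨i, Finset.mem_univ _, Finset.card_lt_card (YoungDiagram.cells_ssubset_iff.2 hi)⟩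
  covBy_grade x y h := by
    obtain ⟨i, hi, hj⟩ := Pi.covBy_iff.1 h
    rw [Nat.covBy_iff_add_one_eq, ← Finset.add_sum_erase _ _ (Finset.mem_univ i),
      ← Finset.add_sum_erase _ (fun i => (y i).card) (Finset.mem_univ i), card_covBy hi,
      Finset.sum_congr rfl (fun j hj' => by rw [hj j (Finset.ne_of_mem_erase hj')])]
    ring

theorem finite_card_le (n : ℕ) : {μ : YoungDiagram | μ.card ≤ n}.Finite := by
  refine Set.Finite.of_finite_image (f := YoungDiagram.cells)
    (Set.Finite.subset (Finset.range n ×ˢ Finset.range n).powerset.finite_toSet ?_)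
    (fun μ _ ν _ h => YoungDiagram.ext h)
  rintro _ ⟨μ, hμ, rfl⟩
  simp only [Finset.coe_powerset, Set.mem_preimage, Set.mem_powerset_iff, Finset.coe_subset]
  rintro ⟨i, j⟩ hij
  have hi : (Finset.range (i + 1)).image (fun a => (a, j)) ⊆ μ.cells := by
    intro c hc
    obtain ⟨a, ha, rfl⟩ := Finset.mem_image.1 hc
    exact μ.up_left_mem (by simpa [Nat.lt_succ_iff] using ha) le_rfl hij
  have hj : (Finset.range (j + 1)).image (fun a => (i, a)) ⊆ μ.cells := by
    intro c hc
    obtain ⟨a, ha, rfl⟩ := Finset.mem_image.1 hc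
    exact μ.up_left_mem le_rfl (by simpa [Nat.lt_succ_iff] using ha) hij
  have h1 := Finset.card_le_card hi
  have h2 := Finset.card_le_card hj
  rw [Finset.card_image_of_injective _ (fun a b h => (Prod.mk.inj h).1), Finset.card_range] at h1
  rw [Finset.card_image_of_injective _ (fun a b h => (Prod.mk.inj h).2), Finset.card_range] at h2
  have hμ' : μ.cells.card ≤ n := hμ
  simp only [Finset.mem_product, Finset.mem_range]
  omega

instance (r n : ℕ) : Finite (GradedPoset.Rank (YoungPower r) n) := by
  have h : {x : YoungPower r | grade ℕ x = n}.Finite := by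
    refine Set.Finite.subset (Set.Finite.pi' (fun _ : Fin r => finite_card_le n)) ?_
    intro x hx i
    have hx' : ∑ i, (x i).card = n := hx
    rw [Set.mem_ofPred_eq, ← hx']
    exact Finset.single_le_sum (f := fun i => (x i).card) (fun _ _ => Nat.zero_le _)
      (Finset.mem_univ i)
  exact h.to_subtype

end YoungPower

/-! ### Polynomials in up-down operators -/

/-! Both families give differential posets: in the natural bases `DU` is `UᵀU`, `UD` is `UUᵀ`, and
`DU - UD = r`. For Young's lattice this is a count of common covers; for a tower it is Frobenius
reciprocity in the bases of irreducible characters. Everything else follows from the relation,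
applied to `A = UD` on one rank.

Since `q(UUᵀ) = q(0) + U p(UᵀU) Uᵀ` with `q = q(0) + X p`, an annihilating polynomial with simple
roots `S` on one rank gives one with roots `{0} ∪ (S + r)` on the next. To see that it is minimal,
even modulo every prime, one follows two distinct elements `x`, `y` up the poset, replacing each by
an element that covers nothing else. Rows of `U` at such elements are unit vectors, so the `(x, y)`
entry of a polynomial in `A` passes unchanged to the next rank, and `q(0)` does not contribute off
the diagonal. Hence the `(x, y)` entry of `q(A)` is the coefficient of `q` in degree `|S| - 1`, for
all `q` of at most that degree (`ReadsCoeff.step`). Such elements never run out, by a count of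
covers (`card_single_rows`, `IsTail.exists_above`).

Let `F` be the product of the `X - s`, `s ∈ S`. Dividing `F` by `X + c` gives a monic `G` with `(A +
c) G(A) = -F(-c)`, a scalar equal up to sign to the product of the `s + c`, while `G(A)` has an
entry 1. So if `A + c` is nonsingular, this scalar is the exact denominator of its inverse, which is
the last Smith invariant (`isLastSmithInvariant_iff_of_mul_eq`). The numbers `s + c` are exactly the
eigenvalues of `A + c`, and `DU + k = A + (r + k)`.

Rank growth: `UᵀU` is nonsingular because its eigenvalues `s + r` are positive, whereas `0` is an
eigenvalue of `UUᵀ` from rank 2 on; so `U` cannot be square. -/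

namespace UpDown

open Polynomial Matrix

section Step

variable {k l m : Type*} [Fintype k] [Fintype l] [Fintype m]
  [DecidableEq k] [DecidableEq l] [DecidableEq m]

/-- The `(x, y)` entry of a polynomial of degree at most `d` in `A` is its coefficient at `d`. -/
def ReadsCoeff (A : Matrix m m ℤ) (d : ℕ) (x y : m) : Prop :=
  ∀ q : ℤ[X], q.natDegree ≤ d → (aeval A q) x y = q.coeff d

theorem aeval_mul_intertwine {A : Matrix m m ℤ} {B : Matrix l l ℤ} {V : Matrix l m ℤ}
    (h : B * V = V * A) (q : ℤ[X]) : aeval B q * V = V * aeval A q := by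
  induction q using Polynomial.induction_on' with
  | add p q hp hq => simp only [map_add, Matrix.add_mul, Matrix.mul_add, hp, hq]
  | monomial n a =>
    have hpow : B ^ n * V = V * A ^ n := by
      induction n with
      | zero => simp
      | succ n ih => rw [pow_succ, Matrix.mul_assoc, h, ← Matrix.mul_assoc, ih, Matrix.mul_assoc,
          ← pow_succ]
    simp only [aeval_monomial, eq_intCast, ← zsmul_eq_mul, Matrix.smul_mul,
      Matrix.mul_smul, hpow]

/-- `V` intertwines `VᵀV` and `VVᵀ`, so all but one factor `VVᵀ` can be moved to the smaller side,
where `VᵀV` is `A` shifted by `r`. -/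
theorem aeval_mul_transpose {A : Matrix m m ℤ} {V : Matrix l m ℤ} {r : ℤ}
    (h : Vᵀ * V = A + r • (1 : Matrix m m ℤ)) (q : ℤ[X]) :
    aeval (V * Vᵀ) (X * q) = V * aeval A (q.comp (X + C r)) * Vᵀ := by
  have h1 : V * Vᵀ * V = V * (A + r • (1 : Matrix m m ℤ)) := by rw [Matrix.mul_assoc, h]
  have h2 : aeval A (q.comp (X + C r)) = aeval (A + r • (1 : Matrix m m ℤ)) q := by
    rw [aeval_comp]
    congr 1
    simp [Algebra.smul_def]
  rw [h2, ← aeval_mul_intertwine h1, mul_comm, map_mul, aeval_X, Matrix.mul_assoc]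

theorem mul_mul_transpose_apply {ι : Type*} {V : Matrix ι m ℤ} (M : Matrix m m ℤ) {x y : m}
    {x' y' : ι}
    (hx : V x' = Pi.single x 1) (hy : V y' = Pi.single y 1) : (V * M * Vᵀ) x' y' = M x y := by
  rw [Matrix.mul_apply]
  simp only [Matrix.transpose_apply, hy, Matrix.mul_apply, hx]
  simp [Pi.single_apply]

/-- The inductive step for minimality: dividing by `X` lowers the degree by one, and the translation
by `r` does not affect the top coefficient. -/
theorem ReadsCoeff.step {A : Matrix m m ℤ} {V : Matrix l m ℤ} {r : ℤ}
    (h : Vᵀ * V = A + r • (1 : Matrix m m ℤ)) {d : ℕ} {x y : m} (hA : ReadsCoeff A d x y)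
    {x' y' : l} (hx : V x' = Pi.single x 1) (hy : V y' = Pi.single y 1) (hne : x' ≠ y') :
    ReadsCoeff (V * Vᵀ) (d + 1) x' y' := by
  intro q hq
  have hdeg : (q.divX.comp (X + C r)).natDegree ≤ d := by
    rw [natDegree_comp, natDegree_X_add_C, mul_one, natDegree_divX_eq_natDegree_tsub_one]
    omega
  have hcoeff : (q.divX.comp (X + C r)).coeff d = q.coeff (d + 1) := by
    rw [← coeff_divX]
    have hd : q.divX.natDegree ≤ d := by
      rw [natDegree_divX_eq_natDegree_tsub_one]; omega
    rcases hd.eq_or_lt with hd | hd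
    · have h1 : (q.divX.comp (X + C r)).natDegree = d := by
        rw [natDegree_comp, natDegree_X_add_C, mul_one, hd]
      conv_lhs => rw [← h1]
      conv_rhs => rw [← hd]
      rw [coeff_natDegree, coeff_natDegree,
        leadingCoeff_comp (by rw [natDegree_X_add_C]; exact one_ne_zero), leadingCoeff_X_add_C,
        one_pow, mul_one]
    · rw [coeff_eq_zero_of_natDegree_lt hd, coeff_eq_zero_of_natDegree_lt]
      rwa [natDegree_comp, natDegree_X_add_C, mul_one]
  -- The constant term of `q` contributes a scalar matrix, which vanishes at `(x', y')` because `x'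
  -- ≠ y'`.
  conv_lhs => rw [← divX_mul_X_add q, mul_comm]
  rw [map_add, Matrix.add_apply, aeval_mul_transpose h, mul_mul_transpose_apply _ hx hy,
    hA _ hdeg, hcoeff, aeval_C]
  simp [Matrix.algebraMap_matrix_apply, hne]

/-- The factor `X` supplies the new root `0`, the others are the old roots moved by `r`. Positivity
of `s + r` keeps `0` apart from them, so that the roots stay simple. -/
theorem aeval_prod_step {A : Matrix m m ℤ} {V : Matrix l m ℤ} {r : ℤ}
    (h : Vᵀ * V = A + r • (1 : Matrix m m ℤ)) {S : Finset ℤ}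
    (hS : aeval A (∏ s ∈ S, (X - C s)) = 0) (h0 : ∀ s ∈ S, 0 < s + r) :
    aeval (V * Vᵀ) (∏ s ∈ insert 0 (S.image (· + r)), (X - C s)) = 0 := by
  rw [Finset.prod_insert, C_0, sub_zero, aeval_mul_transpose h, Finset.prod_image]
  · have : (∏ s ∈ S, (X - C (s + r))).comp (X + C r) = ∏ s ∈ S, (X - C s) := by
      rw [Polynomial.prod_comp]
      refine Finset.prod_congr rfl fun s _ => ?_
      simp only [map_add, sub_comp, X_comp, add_comp, C_comp]
      ring
    rw [this, hS, Matrix.mul_zero, Matrix.zero_mul]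
  · intro a _ b _ hab
    exact add_right_cancel hab
  · intro hmem
    obtain ⟨s, hs, hs0⟩ := Finset.mem_image.1 hmem
    exact (h0 s hs).ne' hs0

theorem card_insert_image {S : Finset ℤ} {r : ℤ} (h0 : ∀ s ∈ S, 0 < s + r) :
    (insert 0 (S.image (· + r))).card = S.card + 1 := by
  rw [Finset.card_insert_of_notMem, Finset.card_image_of_injective _ (add_left_injective r)]
  intro hmem
  obtain ⟨s, hs, hs0⟩ := Finset.mem_image.1 hmem
  exact (h0 s hs).ne' hs0

open Classical in
/-- Among the upper covers of an element `x` that covers only `w`, few cover anything but `x`. -/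
theorem card_single_rows {ι : Type*} [Fintype ι] {V : Matrix m k ℤ} {V' : Matrix ι m ℤ} {r : ℤ}
    (h01 : ∀ y x, V' y x = 0 ∨ V' y x = 1)
    (h : V'ᵀ * V' = V * Vᵀ + r • (1 : Matrix m m ℤ)) {x : m} {w : k} (hx : V x = Pi.single w 1) :
    r + 2 - ∑ z, V z w ≤ (Finset.univ.filter fun y => V' y = Pi.single x 1).card ∧
      ∑ y, V' y x = r + 1 := by
  have e1 : ∀ z, (V * Vᵀ) x z = V z w := by
    intro z
    rw [Matrix.mul_apply]
    simp [hx, Pi.single_apply]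
  have e2 : ∑ y, V' y x = r + 1 := by
    have := congrFun (congrFun h x) x
    rw [Matrix.add_apply, e1, hx, Matrix.mul_apply] at this
    simp only [Matrix.transpose_apply, Pi.single_eq_same, Matrix.smul_apply, Matrix.one_apply_eq,
      smul_eq_mul, mul_one] at this
    rw [add_comm, ← this]
    refine Finset.sum_congr rfl fun y _ => ?_
    rcases h01 y x with e | e <;> simp [e]
  refine ⟨?_, e2⟩
  -- The row sum of the relation at `x` counts the lower covers of all upper covers of `x`.
  have e3 : ∑ y, V' y x * ∑ z, V' y z = ∑ z, V z w + r := by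
    have : ∑ z, (V'ᵀ * V') x z = ∑ z, V z w + r := by
      rw [h]
      simp only [Matrix.add_apply, e1, Finset.sum_add_distrib, Matrix.smul_apply, smul_eq_mul]
      rw [← Finset.mul_sum]
      simp [Matrix.one_apply]
    rw [← this]
    simp only [Matrix.mul_apply, Matrix.transpose_apply, Finset.mul_sum]
    rw [Finset.sum_comm]
  -- An upper cover `y` of `x` gets weight 2 minus its number of lower covers: 1 if it covers only
  -- `x`, and at most 0 otherwise. Summing gives `2(r + 1) - (∑ z, V z w + r)` as a lower bound.
  have e4 : ∀ y, V' y x * (2 - ∑ z, V' y z) ≤ if V' y = Pi.single x 1 then 1 else 0 := by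
    intro y
    have hnn : ∀ z, 0 ≤ V' y z := fun z => by rcases h01 y z with e | e <;> simp [e]
    rcases h01 y x with e | e
    · rw [e, zero_mul]; split_ifs <;> simp
    · rw [e, one_mul]
      split_ifs with hs
      · rw [hs]; simp
      · have : ∃ z, z ≠ x ∧ V' y z = 1 := by
          by_contra hcon
          push Not at hcon
          apply hs
          funext z
          by_cases hz : z = x
          · subst hz; simp [e]
          · rw [Pi.single_eq_of_ne hz]
            exact (h01 y z).resolve_right (hcon z hz)
        obtain ⟨z, hz, hz1⟩ := this
        have := Finset.add_le_sum (fun i (_ : i ∈ Finset.univ) => hnn i) (Finset.mem_univ z)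
          (Finset.mem_univ x) hz
        rw [e, hz1] at this
        linarith
  have e5 := Finset.sum_le_sum fun y (_ : y ∈ Finset.univ) => e4 y
  simp only [mul_sub, Finset.sum_sub_distrib, e3] at e5
  rw [← Finset.sum_mul, e2] at e5
  rw [Finset.card_filter]
  push_cast
  linarith

end Step

/-- The up maps of a differential poset: `U n` is a matrix of zeros and ones, there is one element
of rank `0`, elements of rank `1` are not minimal, and `DU - UD = r`. -/
structure IsDifferentialSystem {P : ℕ → Type*} [∀ n, Fintype (P n)] [∀ n, DecidableEq (P n)]
    (U : ∀ n, Matrix (P (n + 1)) (P n) ℤ) (r : ℕ) : Prop where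
  zero_or_one : ∀ n y x, U n y x = 0 ∨ U n y x = 1
  nonempty : Nonempty (P 0)
  subsingleton : Subsingleton (P 0)
  not_minimal : ∀ y : P 1, ∃ x, U 0 y x = 1
  zero : (U 0)ᵀ * U 0 = (r : ℤ) • (1 : Matrix (P 0) (P 0) ℤ)
  succ : ∀ n, (U (n + 1))ᵀ * U (n + 1) =
    U n * (U n)ᵀ + (r : ℤ) • (1 : Matrix (P (n + 1)) (P (n + 1)) ℤ)

/-! ### Chains of elements with a single lower cover -/

section System

variable {P : ℕ → Type*} [∀ n, Fintype (P n)] [∀ n, DecidableEq (P n)]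
  {U : ∀ n, Matrix (P (n + 1)) (P n) ℤ} {r : ℕ}

/-- The operator `UD`. -/
def ud (U : ∀ n, Matrix (P (n + 1)) (P n) ℤ) : ∀ n, Matrix (P n) (P n) ℤ
  | 0 => 0
  | n + 1 => U n * (U n)ᵀ

theorem IsDifferentialSystem.down_up (h : IsDifferentialSystem U r) (n : ℕ) :
    (U n)ᵀ * U n = ud U n + (r : ℤ) • (1 : Matrix (P n) (P n) ℤ) := by
  cases n with
  | zero => rw [h.zero, ud, zero_add]
  | succ n => exact h.succ n

/-- `A` is annihilated by the polynomial whose simple roots are the nonnegative integers in `S`,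
and the `(x, y)` entry witnesses that no monic polynomial of smaller degree annihilates `A`, not
even modulo a prime. -/
structure IsSimpleSpectrum {m : Type*} [Fintype m] [DecidableEq m] (A : Matrix m m ℤ)
    (S : Finset ℤ) (x y : m) : Prop where
  nonneg : ∀ s ∈ S, 0 ≤ s
  nonempty : S.Nonempty
  aeval_eq_zero : aeval A (∏ s ∈ S, (X - C s)) = 0
  reads : ReadsCoeff A (S.card - 1) x y

theorem IsSimpleSpectrum.step {l m : Type*} [Fintype m] [DecidableEq m] [Fintype l] [DecidableEq l]
    {A : Matrix m m ℤ} {S : Finset ℤ} {x y : m} (hA : IsSimpleSpectrum A S x y)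
    {V : Matrix l m ℤ} {r : ℤ} (hr : 0 < r) (h : Vᵀ * V = A + r • (1 : Matrix m m ℤ))
    {x' y' : l} (hx : V x' = Pi.single x 1) (hy : V y' = Pi.single y 1) (hne : x' ≠ y') :
    IsSimpleSpectrum (V * Vᵀ) (insert 0 (S.image (· + r))) x' y' := by
  have h0 : ∀ s ∈ S, 0 < s + r := fun s hs => by have := hA.nonneg s hs; omega
  refine ⟨?_, Finset.insert_nonempty _ _, aeval_prod_step h hA.aeval_eq_zero h0, ?_⟩
  · intro s hs
    rcases Finset.mem_insert.1 hs with rfl | hs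
    · rfl
    · obtain ⟨t, ht, rfl⟩ := Finset.mem_image.1 hs
      exact (h0 t ht).le
  -- Nonemptiness of `S` makes the truncated subtraction in `S.card - 1` exact.
  · have := Finset.card_pos.2 hA.nonempty
    rw [card_insert_image h0, show S.card + 1 - 1 = S.card - 1 + 1 by omega]
    exact hA.reads.step h hx hy hne

/-- An element of rank `n + 1` that covers only one element, which in turn has at most `r + 1`
upper covers. -/
def IsTail (U : ∀ n, Matrix (P (n + 1)) (P n) ℤ) (r n : ℕ) (x : P (n + 1)) : Prop :=
  ∃ w, U n x = Pi.single w 1 ∧ ∑ z, U n z w ≤ r + 1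

/-- The bound `r + 1` leaves at least `r + 2 - (r + 1) = 1` upper cover with `x` as its only lower
cover. It is again a tail, since `x` has exactly `r + 1` upper covers. -/
theorem IsTail.exists_above (h : IsDifferentialSystem U r) {n : ℕ} {x : P (n + 1)}
    (hx : IsTail U r n x) : ∃ x', U (n + 1) x' = Pi.single x 1 ∧ IsTail U r (n + 1) x' := by
  classical
  obtain ⟨w, hw, hs⟩ := hx
  obtain ⟨h1, h2⟩ := card_single_rows (h.zero_or_one (n + 1)) (h.succ n) hw
  have h3 : 0 < (Finset.univ.filter fun y => U (n + 1) y = Pi.single x 1).card := by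
    zify; linarith
  obtain ⟨x', hx'⟩ := Finset.card_pos.1 h3
  rw [Finset.mem_filter] at hx'
  exact ⟨x', hx'.2, x, hx'.2, h2.le⟩

theorem IsDifferentialSystem.row_zero (h : IsDifferentialSystem U r) (y : P 1) (x : P 0) :
    U 0 y = Pi.single x 1 := by
  have := h.subsingleton
  obtain ⟨x', hx'⟩ := h.not_minimal y
  funext z
  rw [Subsingleton.elim z x, Pi.single_eq_same, Subsingleton.elim x x', hx']

theorem IsDifferentialSystem.card_one (h : IsDifferentialSystem U r) : Fintype.card (P 1) = r := by
  obtain ⟨x⟩ := h.nonempty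
  have := congrFun (congrFun h.zero x) x
  rw [Matrix.mul_apply] at this
  simp only [Matrix.transpose_apply, h.row_zero _ x] at this
  simpa using this

theorem IsDifferentialSystem.isTail_one (h : IsDifferentialSystem U r) (y : P 1) :
    IsTail U r 0 y := by
  obtain ⟨x⟩ := h.nonempty
  refine ⟨x, h.row_zero y x, ?_⟩
  simp only [h.row_zero _ x]
  simp [h.card_one]

theorem IsDifferentialSystem.spectrum_zero (h : IsDifferentialSystem U r) (x : P 0) :
    IsSimpleSpectrum (ud U 0) {0} x x := by
  have := h.subsingleton
  refine ⟨by simp, by simp, by simp [ud], fun q hq => ?_⟩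
  simp only [Finset.card_singleton, tsub_self, nonpos_iff_eq_zero] at hq ⊢
  rw [eq_C_of_natDegree_eq_zero hq, aeval_C]
  simp [Matrix.algebraMap_matrix_apply]

/-- The exceptional rank: for `r = 1` rank 1 is a single element, so the general step has no
distinct pair to use, and `0` does not enter the spectrum. -/
theorem IsDifferentialSystem.spectrum_one (h : IsDifferentialSystem U 1) (x : P 1) :
    IsSimpleSpectrum (ud U 1) {1} x x := by
  have hc := h.card_one
  have hsub : Subsingleton (P 1) := Fintype.card_le_one_iff_subsingleton.1 hc.le
  obtain ⟨w⟩ := h.nonempty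
  have hud : ud U 1 = 1 := by
    ext a b
    rw [Subsingleton.elim a b, Matrix.one_apply_eq, ud, Matrix.mul_apply]
    have := h.subsingleton
    simp [h.row_zero _ w, Pi.single_apply]
  refine ⟨by simp, by simp, by simp [hud], fun q hq => ?_⟩
  simp only [Finset.card_singleton, tsub_self, nonpos_iff_eq_zero] at hq ⊢
  rw [eq_C_of_natDegree_eq_zero hq, aeval_C]
  simp [Matrix.algebraMap_matrix_apply]

theorem IsDifferentialSystem.exists_tails_succ (h : IsDifferentialSystem U r) (hr : 1 ≤ r) {n : ℕ}
    (hn : ∃ (S : Finset ℤ) (x y : P (n + 1)), x ≠ y ∧ IsTail U r n x ∧ IsTail U r n y ∧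
      IsSimpleSpectrum (ud U (n + 1)) S x y) :
    ∃ (S : Finset ℤ) (x y : P (n + 2)), 0 ∈ S ∧ x ≠ y ∧ IsTail U r (n + 1) x ∧
      IsTail U r (n + 1) y ∧ IsSimpleSpectrum (ud U (n + 2)) S x y := by
  obtain ⟨S, x, y, hxy, hx, hy, hS⟩ := hn
  obtain ⟨x', hx', tx⟩ := hx.exists_above h
  obtain ⟨y', hy', ty⟩ := hy.exists_above h
  -- Each of `x'`, `y'` determines its only lower cover, so the two chains stay disjoint.
  have hne : x' ≠ y' := by
    rintro rfl
    rw [hx'] at hy'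
    have := congrFun hy' x
    rw [Pi.single_eq_same, Pi.single_eq_of_ne hxy] at this
    exact one_ne_zero this
  exact ⟨_, x', y', Finset.mem_insert_self _ _, hne, tx, ty,
    hS.step (by exact_mod_cast hr) (h.down_up (n + 1)) hx' hy' hne⟩

theorem IsDifferentialSystem.exists_tails_one (h : IsDifferentialSystem U r) (hr : 2 ≤ r) :
    ∃ (S : Finset ℤ) (x y : P 1), x ≠ y ∧ IsTail U r 0 x ∧ IsTail U r 0 y ∧
      IsSimpleSpectrum (ud U 1) S x y := by
  obtain ⟨w⟩ := h.nonempty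
  have : 1 < Fintype.card (P 1) := by rw [h.card_one]; omega
  obtain ⟨x, y, hxy⟩ := Fintype.one_lt_card_iff.1 this
  exact ⟨_, x, y, hxy, h.isTail_one x, h.isTail_one y,
    (h.spectrum_zero w).step (by exact_mod_cast (show 0 < r by omega)) (h.down_up 0)
      (h.row_zero x w) (h.row_zero y w) hxy⟩

/-- For `r = 1` the chain splits only at rank 2: the bottom element has one upper cover `v`, so the
count gives at least `3 - 1 = 2` elements that cover only `v`. -/
theorem IsDifferentialSystem.exists_tails_two (h : IsDifferentialSystem U 1) :
    ∃ (S : Finset ℤ) (x y : P 2), 0 ∈ S ∧ x ≠ y ∧ IsTail U 1 1 x ∧ IsTail U 1 1 y ∧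
      IsSimpleSpectrum (ud U 2) S x y := by
  classical
  obtain ⟨w⟩ := h.nonempty
  have : 0 < Fintype.card (P 1) := by rw [h.card_one]; omega
  obtain ⟨v⟩ := Fintype.card_pos_iff.1 this
  obtain ⟨h1, h2⟩ := card_single_rows (h.zero_or_one 1) (h.succ 0)
    (h.row_zero v w)
  have hw : ∑ z, U 0 z w = 1 := by
    simp only [h.row_zero _ w]
    simp [h.card_one]
  rw [hw] at h1
  have h3 : 1 < (Finset.univ.filter fun y => U 1 y = Pi.single v 1).card := by
    zify; push_cast at h1; linarith
  obtain ⟨x, hx, y, hy, hxy⟩ := Finset.one_lt_card.1 h3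
  rw [Finset.mem_filter] at hx hy
  exact ⟨_, x, y, Finset.mem_insert_self _ _, hxy, ⟨v, hx.2, h2.le⟩, ⟨v, hy.2, h2.le⟩,
    (h.spectrum_one v).step one_pos (h.down_up 1) hx.2 hy.2 hxy⟩

theorem IsDifferentialSystem.exists_tails (h : IsDifferentialSystem U r) (hr : 1 ≤ r) (n : ℕ) :
    ∃ (S : Finset ℤ) (x y : P (n + 2)), 0 ∈ S ∧ x ≠ y ∧ IsTail U r (n + 1) x ∧
      IsTail U r (n + 1) y ∧ IsSimpleSpectrum (ud U (n + 2)) S x y := by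
  induction n with
  | zero =>
    rcases hr.eq_or_lt with rfl | hr'
    · exact h.exists_tails_two
    · exact h.exists_tails_succ hr (h.exists_tails_one hr')
  | succ n ih =>
    obtain ⟨S, x, y, -, hS⟩ := ih
    exact h.exists_tails_succ hr ⟨S, x, y, hS⟩

theorem IsDifferentialSystem.exists_spectrum (h : IsDifferentialSystem U r) (hr : 1 ≤ r) (n : ℕ) :
    ∃ (S : Finset ℤ) (x y : P n), (2 ≤ n → 0 ∈ S) ∧ IsSimpleSpectrum (ud U n) S x y := by
  match n with
  | 0 =>
    obtain ⟨w⟩ := h.nonempty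
    exact ⟨_, w, w, by simp, h.spectrum_zero w⟩
  | 1 =>
    rcases hr.eq_or_lt with rfl | hr'
    · have : 0 < Fintype.card (P 1) := by rw [h.card_one]; omega
      obtain ⟨v⟩ := Fintype.card_pos_iff.1 this
      exact ⟨_, v, v, by omega, h.spectrum_one v⟩
    · obtain ⟨S, x, y, -, -, -, hS⟩ := h.exists_tails_one hr'
      exact ⟨S, x, y, by omega, hS⟩
  | n + 2 =>
    obtain ⟨S, x, y, h0, -, -, -, hS⟩ := h.exists_tails hr n
    exact ⟨S, x, y, fun _ => h0, hS⟩

end System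

end UpDown

/-! ### Smith forms over the integers -/

section Smith

open Matrix

variable {m l : Type*} [Fintype m] [DecidableEq m] [Fintype l] [DecidableEq l]

/-- Two square matrices are equivalent if they differ by unimodular row and column operations. -/
def UnimodularEquiv (A B : Matrix m m ℤ) : Prop :=
  ∃ P Q : GL m ℤ, (P : Matrix m m ℤ) * A * (Q : Matrix m m ℤ) = B

namespace UnimodularEquiv

theorem refl (A : Matrix m m ℤ) : UnimodularEquiv A A := ⟨1, 1, by simp⟩

theorem trans {A B C : Matrix m m ℤ} (h : UnimodularEquiv A B) (h' : UnimodularEquiv B C) :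
    UnimodularEquiv A C := by
  obtain ⟨P, Q, rfl⟩ := h
  obtain ⟨P', Q', rfl⟩ := h'
  exact ⟨P' * P, Q * Q', by simp only [Units.val_mul, Matrix.mul_assoc]⟩

theorem of_isUnit {A P Q : Matrix m m ℤ} (hP : IsUnit P) (hQ : IsUnit Q) :
    UnimodularEquiv A (P * A * Q) :=
  ⟨hP.unit, hQ.unit, rfl⟩

theorem of_isUnit_det {A P Q : Matrix m m ℤ} (hP : IsUnit P.det) (hQ : IsUnit Q.det) :
    UnimodularEquiv A (P * A * Q) :=
  of_isUnit ((Matrix.isUnit_iff_isUnit_det P).2 hP) ((Matrix.isUnit_iff_isUnit_det Q).2 hQ)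

theorem row_transvection (A : Matrix m m ℤ) {i j : m} (hij : i ≠ j) (c : ℤ) :
    UnimodularEquiv A (transvection i j c * A) := by
  simpa using of_isUnit_det (A := A) (P := transvection i j c) (Q := 1)
    (by rw [det_transvection_of_ne i j hij]; exact isUnit_one) (by simp)

theorem col_transvection (A : Matrix m m ℤ) {i j : m} (hij : i ≠ j) (c : ℤ) :
    UnimodularEquiv A (A * transvection i j c) := by
  simpa using of_isUnit_det (A := A) (P := 1) (Q := transvection i j c)
    (by simp) (by rw [det_transvection_of_ne i j hij]; exact isUnit_one)

theorem submatrix_perm (A : Matrix m m ℤ) (σ τ : Equiv.Perm m) :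
    UnimodularEquiv A (A.submatrix σ τ) := by
  have hu : ∀ σ : Equiv.Perm m, IsUnit ((1 : Matrix m m ℤ).submatrix σ id).det := fun σ => by
    rw [Matrix.det_permute, Matrix.det_one, mul_one]
    exact (Equiv.Perm.sign σ).isUnit.map (Int.castRingHom ℤ)
  have hu' : ∀ σ : Equiv.Perm m, IsUnit ((1 : Matrix m m ℤ).submatrix id σ).det := fun σ => by
    rw [Matrix.det_permute', Matrix.det_one, mul_one]
    exact (Equiv.Perm.sign σ).isUnit.map (Int.castRingHom ℤ)
  have := of_isUnit_det (A := A) (hu σ) (hu' τ)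
  convert! this using 1
  ext i j
  simp [Matrix.mul_apply, Matrix.one_apply]

theorem submatrix {A B : Matrix m m ℤ} (h : UnimodularEquiv A B) (e : l ≃ m) :
    UnimodularEquiv (A.submatrix e e) (B.submatrix e e) := by
  obtain ⟨P, Q, rfl⟩ := h
  have hu : ∀ P : GL m ℤ, IsUnit ((P : Matrix m m ℤ).submatrix e e).det := fun P => by
    rw [Matrix.det_submatrix_equiv_self]
    exact (Matrix.isUnit_iff_isUnit_det _).1 P.isUnit
  have := of_isUnit_det (A := A.submatrix e e) (hu P) (hu Q)
  rwa [Matrix.submatrix_mul_equiv, Matrix.submatrix_mul_equiv] at this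

theorem smul {A B : Matrix m m ℤ} (h : UnimodularEquiv A B) (c : ℤ) :
    UnimodularEquiv (c • A) (c • B) := by
  obtain ⟨P, Q, rfl⟩ := h
  exact ⟨P, Q, by rw [Matrix.mul_smul, Matrix.smul_mul]⟩

theorem fromBlocks {A B : Matrix m m ℤ} (h : UnimodularEquiv A B) (D : Matrix l l ℤ) :
    UnimodularEquiv (Matrix.fromBlocks A 0 0 D) (Matrix.fromBlocks B 0 0 D) := by
  obtain ⟨P, Q, rfl⟩ := h
  have hu : ∀ P : GL m ℤ,
      IsUnit (Matrix.fromBlocks (P : Matrix m m ℤ) 0 0 (1 : Matrix l l ℤ)).det := fun P => by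
    rw [Matrix.det_fromBlocks_zero₂₁, Matrix.det_one, mul_one]
    exact (Matrix.isUnit_iff_isUnit_det _).1 P.isUnit
  have := of_isUnit_det (A := Matrix.fromBlocks A 0 0 D) (hu P) (hu Q)
  simpa [Matrix.fromBlocks_multiply] using this

/-- Clearing the last row and the last column by a pivot that divides them. -/
theorem clear {A : Matrix (m ⊕ Unit) (m ⊕ Unit) ℤ}
    (hr : ∀ i, A (Sum.inr ()) (Sum.inr ()) ∣ A (Sum.inl i) (Sum.inr ()))
    (hc : ∀ i, A (Sum.inr ()) (Sum.inr ()) ∣ A (Sum.inr ()) (Sum.inl i)) :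
    ∃ D : Matrix m m ℤ, UnimodularEquiv A
      (Matrix.fromBlocks D 0 0 (Matrix.of fun _ _ => A (Sum.inr ()) (Sum.inr ()))) := by
  set a := A (Sum.inr ()) (Sum.inr ()) with ha
  choose b hb using hr
  choose c hc using hc
  have := of_isUnit_det (A := A)
    (P := Matrix.fromBlocks 1 (Matrix.of fun i _ => -b i) 0 1)
    (Q := Matrix.fromBlocks 1 0 (Matrix.of fun _ i => -c i) 1) (by simp) (by simp)
  refine ⟨A.toBlocks₁₁ + -(Matrix.of fun i j => b i * A (Sum.inr ()) (Sum.inl j)), ?_⟩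
  convert! this using 1
  conv_rhs => rw [← Matrix.fromBlocks_toBlocks A]
  rw [Matrix.fromBlocks_multiply, Matrix.fromBlocks_multiply, eq_comm, Matrix.fromBlocks_inj]
  refine ⟨?_, ?_, ?_, ?_⟩
  · ext i j
    simp [Matrix.toBlocks₁₁, Matrix.toBlocks₂₁, Matrix.toBlocks₁₂, Matrix.toBlocks₂₂,
      Matrix.mul_apply, ← ha, hb, hc]
    left
    ring
  · ext i j
    simp [Matrix.toBlocks₁₂, Matrix.toBlocks₂₂, Matrix.mul_apply, ← ha, hb]
    ring
  · ext i j
    simp [Matrix.toBlocks₂₁, Matrix.toBlocks₂₂, Matrix.mul_apply, ← ha, hc]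
  · ext i j
    simp [Matrix.toBlocks₂₂, ← ha]

end UnimodularEquiv

/-- The `(i, j)` entry of `A` is nonzero and of least absolute value among the nonzero entries of
all matrices equivalent to `A`. -/
def IsLeastEntry (A : Matrix m m ℤ) (i j : m) : Prop :=
  A i j ≠ 0 ∧ ∀ B, UnimodularEquiv A B → ∀ i' j', B i' j' ≠ 0 → (A i j).natAbs ≤ (B i' j').natAbs

theorem exists_isLeastEntry {A : Matrix m m ℤ} (hA : A ≠ 0) :
    ∃ B i j, UnimodularEquiv A B ∧ IsLeastEntry B i j := by
  classical
  have hex : ∃ N : ℕ, ∃ B i j, UnimodularEquiv A B ∧ B i j ≠ 0 ∧ (B i j).natAbs = N := by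
    by_contra hcon
    apply hA
    ext i j
    by_contra hne
    exact hcon ⟨_, A, i, j, UnimodularEquiv.refl A, hne, rfl⟩
  obtain ⟨B, i, j, hB, hne, hN⟩ := Nat.find_spec hex
  refine ⟨B, i, j, hB, hne, fun C hC i' j' hne' => ?_⟩
  rw [hN]
  exact Nat.find_min' hex ⟨C, i', j', hB.trans hC, hne', rfl⟩

theorem IsLeastEntry.equiv {A B : Matrix m m ℤ} {i j i' j' : m} (h : IsLeastEntry A i j)
    (hAB : UnimodularEquiv A B) (he : B i' j' = A i j) : IsLeastEntry B i' j' :=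
  ⟨he ▸ h.1, fun C hC k k' hne => he ▸ h.2 C (hAB.trans hC) k k' hne⟩

theorem Int.natAbs_emod_lt {a : ℤ} (b : ℤ) (ha : a ≠ 0) : (b % a).natAbs < a.natAbs := by
  have h1 := Int.emod_nonneg b ha
  have h2 := Int.emod_lt_abs b ha
  rw [Int.abs_eq_natAbs] at h2
  omega

/-- Otherwise a row operation would leave a nonzero remainder of smaller absolute value. -/
theorem IsLeastEntry.dvd_col {A : Matrix m m ℤ} {i j k : m} (h : IsLeastEntry A i j)
    (hk : k ≠ i) : A i j ∣ A k j := by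
  by_contra hnd
  have h1 : (transvection k i (-(A k j / A i j)) * A) k j = A k j % A i j := by
    rw [transvection_mul_apply_same, Int.emod_def]; ring
  have h2 := h.2 _ (UnimodularEquiv.row_transvection A hk (-(A k j / A i j))) k j
    (by rw [h1]; exact fun h0 => hnd (Int.dvd_of_emod_eq_zero h0))
  rw [h1] at h2
  exact absurd (Int.natAbs_emod_lt (A k j) h.1) (not_lt.2 h2)

theorem IsLeastEntry.dvd_row {A : Matrix m m ℤ} {i j k : m} (h : IsLeastEntry A i j)
    (hk : k ≠ j) : A i j ∣ A i k := by
  by_contra hnd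
  have h1 : (A * transvection j k (-(A i k / A i j))) i k = A i k % A i j := by
    rw [mul_transvection_apply_same, Int.emod_def]; ring
  have h2 := h.2 _ (UnimodularEquiv.col_transvection A hk.symm (-(A i k / A i j))) i k
    (by rw [h1]; exact fun h0 => hnd (Int.dvd_of_emod_eq_zero h0))
  rw [h1] at h2
  exact absurd (Int.natAbs_emod_lt (A i k) h.1) (not_lt.2 h2)

theorem exists_pivot {A : Matrix (m ⊕ Unit) (m ⊕ Unit) ℤ} (hA : A ≠ 0) :
    ∃ (a : ℤ) (D : Matrix m m ℤ),
      UnimodularEquiv A (Matrix.fromBlocks (a • D) 0 0 (Matrix.of fun _ _ => a)) := by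
  obtain ⟨B, i, j, hAB, hB⟩ := exists_isLeastEntry hA
  have hBC := UnimodularEquiv.submatrix_perm B (Equiv.swap (Sum.inr ()) i)
    (Equiv.swap (Sum.inr ()) j)
  set C := B.submatrix (Equiv.swap (Sum.inr ()) i) (Equiv.swap (Sum.inr ()) j) with hCdef
  have hC : IsLeastEntry C (Sum.inr ()) (Sum.inr ()) := hB.equiv hBC (by simp [hCdef])
  obtain ⟨D, hD⟩ := UnimodularEquiv.clear (A := C) (fun i => hC.dvd_col (by simp))
    (fun i => hC.dvd_row (by simp))
  set a := C (Sum.inr ()) (Sum.inr ())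
  have hE : IsLeastEntry (Matrix.fromBlocks D 0 0 (Matrix.of fun _ _ => a)) (Sum.inr ())
    (Sum.inr ()) := hC.equiv hD (by simp [a])
  have hdvd : ∀ i j, a ∣ D i j := by
    intro i j
    -- Adding row `i` of `D` to the pivot row keeps the pivot and puts `D i j` into its row, so the
    -- pivot divides it.
    have hF := hE.equiv (i' := Sum.inr ()) (j' := Sum.inr ())
      (UnimodularEquiv.row_transvection _ (i := Sum.inr ()) (j := Sum.inl i) (by simp) 1)
      (by simp)
    have := hF.dvd_row (k := Sum.inl j) (by simp)
    simpa using this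
  choose D' hD' using hdvd
  refine ⟨a, Matrix.of D', (hAB.trans hBC).trans ?_⟩
  convert! hD using 2
  ext i j
  simp [hD']

/-- Existence of the Smith form. -/
theorem exists_unimodularEquiv_diagonal (n : ℕ) (A : Matrix (Fin n) (Fin n) ℤ) :
    ∃ d : Fin n → ℤ, (∀ i j, i ≤ j → d i ∣ d j) ∧ UnimodularEquiv A (Matrix.diagonal d) := by
  induction n with
  | zero => exact ⟨fun _ => 0, fun i => i.elim0, by
      convert! UnimodularEquiv.refl A using 1; ext i; exact i.elim0⟩
  | succ n ih =>
    by_cases hA : A = 0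
    · exact ⟨fun _ => 0, fun _ _ _ => dvd_rfl, by
        convert! UnimodularEquiv.refl A using 1
        rw [hA]; ext i j; simp [Matrix.diagonal_apply]⟩
    -- This sends `0` to the pivot position, so the entry dividing all others comes first.
    let e : Fin (n + 1) ≃ Fin n ⊕ Unit := (finSuccEquiv n).trans (Equiv.optionEquivSumPUnit _)
    have hA' : A.submatrix e.symm e.symm ≠ 0 := by
      intro h0
      apply hA
      have := congrArg (fun M => M.submatrix e e) h0
      simpa using this
    obtain ⟨a, D, hD⟩ := exists_pivot hA'
    obtain ⟨d, hd, hdD⟩ := ih D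
    refine ⟨Fin.cons a fun i => a * d i, ?_, ?_⟩
    · intro i j hij
      induction i using Fin.cases with
      | zero => induction j using Fin.cases <;> simp
      | succ i =>
        induction j using Fin.cases with
        | zero => simp at hij
        | succ j => simpa using mul_dvd_mul_left a (hd i j (by simpa using hij))
    · have := (hD.trans ((hdD.smul a).fromBlocks _)).submatrix e
      rw [Matrix.submatrix_submatrix] at this
      convert! this using 1
      · simp
      · ext i j
        rw [← Matrix.diagonal_smul]
        induction i using Fin.cases <;> induction j using Fin.cases <;>
          simp [e, Matrix.diagonal_apply, Fin.succ_ne_zero, (Fin.succ_ne_zero _).symm]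

theorem exists_isSmithDiagonal (A : Matrix m m ℤ) :
    ∃ d : Fin (Fintype.card m) → ℤ, IsSmithDiagonal A d := by
  let e := Fintype.equivFin m
  obtain ⟨d, hd, h⟩ := exists_unimodularEquiv_diagonal _ (A.submatrix e.symm e.symm)
  obtain ⟨P, Q, hPQ⟩ := h.submatrix e
  refine ⟨d, hd, e, P, Q, ?_⟩
  rw [Matrix.submatrix_submatrix] at hPQ
  simpa only [Function.comp_def, Equiv.symm_apply_apply, Matrix.submatrix_diagonal_equiv,
    Matrix.submatrix_id_id, show (fun x : m => x) = id from rfl] using hPQ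

theorem exists_isLastSmithInvariant [Nonempty m] (A : Matrix m m ℤ) :
    ∃ s, IsLastSmithInvariant A s := by
  obtain ⟨d, hd⟩ := exists_isSmithDiagonal A
  have := Fintype.card_pos (α := m)
  exact ⟨_, d, hd, ⟨Fintype.card m - 1, by omega⟩, by simp; omega, rfl⟩

theorem IsLastSmithInvariant.neg {A : Matrix m m ℤ} {s : ℤ} (h : IsLastSmithInvariant A s) :
    IsLastSmithInvariant A (-s) := by
  obtain ⟨d, ⟨hd, e, P, Q, hPQ⟩, i, hi, rfl⟩ := h
  refine ⟨-d, ⟨fun i j hij => by simpa using hd i j hij, e, -P, Q, ?_⟩, i, hi, rfl⟩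
  rw [Units.val_neg, Matrix.neg_mul, Matrix.neg_mul, hPQ]
  ext a b
  by_cases hab : a = b <;> simp [hab]

/-- Every diagonal entry of a Smith form divides the last one. -/
theorem IsLastSmithInvariant.exists_diagonal {A : Matrix m m ℤ} {s : ℤ}
    (h : IsLastSmithInvariant A s) :
    ∃ (d : m → ℤ) (P Q : GL m ℤ), (P : Matrix m m ℤ) * A * (Q : Matrix m m ℤ) = Matrix.diagonal d ∧
      (∀ x, d x ∣ s) ∧ ∃ x, d x = s := by
  obtain ⟨d, ⟨hd, e, P, Q, hPQ⟩, i, hi, rfl⟩ := h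
  refine ⟨fun x => d (e x), P, Q, hPQ, fun x => hd _ _ ?_, e.symm i, by simp⟩
  have := (e x).2
  rw [Fin.le_def]
  omega

theorem isLastSmithInvariant_iff_of_det_eq_zero {A : Matrix m m ℤ} [Nonempty m] (hA : A.det = 0)
    (s : ℤ) : IsLastSmithInvariant A s ↔ s = 0 := by
  have key : ∀ s, IsLastSmithInvariant A s → s = 0 := by
    intro s hs
    obtain ⟨d, P, Q, hPQ, hd, -⟩ := hs.exists_diagonal
    have := congrArg Matrix.det hPQ
    rw [Matrix.det_mul, Matrix.det_mul, hA, mul_zero, zero_mul, Matrix.det_diagonal] at this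
    obtain ⟨x, -, hx⟩ := Finset.prod_eq_zero_iff.1 this.symm
    exact zero_dvd_iff.1 (hx ▸ hd x)
  refine ⟨key s, ?_⟩
  rintro rfl
  obtain ⟨s, hs⟩ := exists_isLastSmithInvariant A
  rwa [key s hs] at hs

/-- The last Smith invariant is the least common denominator of `A⁻¹ = N / M`, and the unit entry of
`N` excludes any cancellation. The argument applies to every Smith form, so uniqueness up to sign is
not needed beforehand. -/
theorem isLastSmithInvariant_iff_of_mul_eq {A N : Matrix m m ℤ} {M : ℤ} (hM : M ≠ 0)
    (hAN : A * N = M • (1 : Matrix m m ℤ)) {x y : m} (hN : IsUnit (N x y)) (s : ℤ) :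
    IsLastSmithInvariant A s ↔ s = M ∨ s = -M := by
  have key : ∀ s, IsLastSmithInvariant A s → s = M ∨ s = -M := by
    intro s hs
    obtain ⟨d, P, Q, hPQ, hd, z, rfl⟩ := hs.exists_diagonal
    set K : Matrix m m ℤ := ((Q⁻¹ : GL m ℤ) : Matrix m m ℤ) * N * ((P⁻¹ : GL m ℤ) : Matrix m m ℤ)
      with hK
    have h1 : Matrix.diagonal d * K = M • (1 : Matrix m m ℤ) := by
      rw [← hPQ, hK]
      calc (P : Matrix m m ℤ) * A * Q * ((Q⁻¹ : GL m ℤ) * N * (P⁻¹ : GL m ℤ))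
          = (P : Matrix m m ℤ) * A * ((Q : Matrix m m ℤ) * (Q⁻¹ : GL m ℤ)) * N
            * (P⁻¹ : GL m ℤ) := by simp only [Matrix.mul_assoc]
        _ = (P : Matrix m m ℤ) * (A * N) * (P⁻¹ : GL m ℤ) := by
            rw [Units.mul_inv, Matrix.mul_one, Matrix.mul_assoc (P : Matrix m m ℤ)]
        _ = _ := by rw [hAN, Matrix.mul_smul, Matrix.smul_mul, Matrix.mul_one, Units.mul_inv]
    have h2 : ∀ i j, d i * K i j = if i = j then M else 0 := by
      intro i j
      have := congrFun (congrFun h1 i) j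
      rw [Matrix.diagonal_mul] at this
      simpa [Matrix.one_apply] using this
    have hdne : ∀ i, d i ≠ 0 := by
      intro i hi
      have := h2 i i
      rw [hi, zero_mul, if_pos rfl] at this
      exact hM this.symm
    obtain ⟨t, ht⟩ : d z ∣ M := ⟨K z z, by rw [h2, if_pos rfl]⟩
    -- `K` is diagonal with `d i * K i i = M = d z * t`; since `d i` divides `d z`, each entry is a
    -- multiple of `t`.
    have htK : ∀ i j, t ∣ K i j := by
      intro i j
      by_cases hij : i = j
      · obtain ⟨u, hu⟩ := hd i
        subst hij
        refine ⟨u, mul_left_cancel₀ (hdne i) ?_⟩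
        rw [h2, if_pos rfl, ht, hu]; ring
      · have := h2 i j
        rw [if_neg hij] at this
        rw [(mul_eq_zero.1 this).resolve_left (hdne i)]
        exact dvd_zero t
    have hNK : N = (Q : Matrix m m ℤ) * K * (P : Matrix m m ℤ) := by
      rw [hK]
      calc N = ((Q : Matrix m m ℤ) * (Q⁻¹ : GL m ℤ)) * N * ((P⁻¹ : GL m ℤ) * (P : Matrix m m ℤ)) := by
            simp
        _ = _ := by simp only [Matrix.mul_assoc]
    have htN : t ∣ N x y := by
      rw [hNK, Matrix.mul_apply]
      refine Finset.dvd_sum fun j _ => Dvd.dvd.mul_right ?_ _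
      rw [Matrix.mul_apply]
      exact Finset.dvd_sum fun k _ => Dvd.dvd.mul_left (htK k j) _
    rcases Int.isUnit_iff.1 (isUnit_of_dvd_unit htN hN) with rfl | rfl
    · left; rw [ht, mul_one]
    · right; rw [ht]; ring
  refine ⟨key s, fun hs => ?_⟩
  have : Nonempty m := ⟨x⟩
  obtain ⟨s', hs'⟩ := exists_isLastSmithInvariant A
  have h' := key s' hs'
  rcases hs with rfl | rfl <;> rcases h' with rfl | rfl
  · exact hs'
  · simpa using hs'.neg
  · exact hs'.neg
  · exact hs'

end Smith

/-! ### Spectra and last Smith invariants -/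

namespace UpDown

open Polynomial Matrix

section Spectrum

variable {m : Type*} [Fintype m] [DecidableEq m] {A : Matrix m m ℤ} {S : Finset ℤ} {x y : m}

theorem aeval_X_sub_C_eq (A : Matrix m m ℤ) (c : ℤ) :
    aeval A (X - C c) = A - c • (1 : Matrix m m ℤ) := by
  simp [Algebra.smul_def]

theorem eq_zero_of_mul_eq_zero_of_det_ne_zero {A B : Matrix m m ℤ} (hA : A.det ≠ 0)
    (hAB : A * B = 0) : B = 0 := by
  have h : A.det • B = 0 := by
    rw [← Matrix.one_mul B, ← Matrix.smul_mul, ← Matrix.adjugate_mul, Matrix.mul_assoc, hAB,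
      Matrix.mul_zero]
  exact (smul_eq_zero.1 h).resolve_left hA

/-- If `A - s` were nonsingular, it could be cancelled from the annihilating product; the remaining
monic polynomial of degree `|S| - 1` would be zero at `A`, yet its `(x, y)` entry is 1. -/
theorem IsSimpleSpectrum.det_eq_zero (h : IsSimpleSpectrum A S x y) {s : ℤ} (hs : s ∈ S) :
    (A - s • (1 : Matrix m m ℤ)).det = 0 := by
  by_contra hne
  have h0 := h.aeval_eq_zero
  rw [← Finset.mul_prod_erase _ _ hs, map_mul, aeval_X_sub_C_eq] at h0
  have h1 := eq_zero_of_mul_eq_zero_of_det_ne_zero hne h0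
  have hdeg : (∏ s ∈ S.erase s, (X - C s)).natDegree = S.card - 1 := by
    rw [natDegree_prod_of_monic _ _ fun s _ => monic_X_sub_C s]
    simp only [natDegree_X_sub_C, Finset.sum_const, smul_eq_mul, mul_one,
      Finset.card_erase_of_mem hs]
  have hmonic : (∏ s ∈ S.erase s, (X - C s)).Monic := monic_prod_of_monic _ _ fun s _ =>
    monic_X_sub_C s
  have h2 := h.reads _ hdeg.le
  rw [h1, ← hdeg, hmonic.coeff_natDegree] at h2
  exact zero_ne_one h2

/-- A shift of `A` times a polynomial in `A` is scalar, and the polynomial has an entry one. -/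
theorem IsSimpleSpectrum.exists_mul_eq (h : IsSimpleSpectrum A S x y) (c : ℤ) :
    ∃ (N : Matrix m m ℤ) (M : ℤ), (M = ∏ s ∈ S, (s + c) ∨ M = -∏ s ∈ S, (s + c)) ∧
      (A + c • (1 : Matrix m m ℤ)) * N = M • (1 : Matrix m m ℤ) ∧ N x y = 1 := by
  set F : ℤ[X] := ∏ s ∈ S, (X - C s) with hF
  have hmonic : F.Monic := monic_prod_of_monic _ _ fun s _ => monic_X_sub_C s
  have hdeg : F.natDegree = S.card := by
    rw [hF, natDegree_prod_of_monic _ _ fun s _ => monic_X_sub_C s]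
    simp only [natDegree_X_sub_C, Finset.sum_const, smul_eq_mul, mul_one]
  have hpos := Finset.card_pos.2 h.nonempty
  -- `G` is monic of degree `|S| - 1`, exactly the degree whose coefficient the `(x, y)` entry
  -- reads.
  set G := F /ₘ (X - C (-c)) with hG
  have hGdeg : G.natDegree = S.card - 1 := by
    rw [hG, natDegree_divByMonic _ (monic_X_sub_C _), hdeg, natDegree_X_sub_C]
  have hGlead : G.leadingCoeff = 1 := by
    rw [hG, leadingCoeff_divByMonic_X_sub_C, hmonic.leadingCoeff]
    intro h0
    have : F.natDegree = 0 := natDegree_eq_of_degree_eq_some h0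
    omega
  have hmul : (X - C (-c)) * G = F - C (F.eval (-c)) := by
    rw [X_sub_C_mul_divByMonic_eq_sub_modByMonic, modByMonic_X_sub_C_eq_C_eval]
  refine ⟨aeval A G, -F.eval (-c), ?_, ?_, ?_⟩
  · have : F.eval (-c) = (-1) ^ S.card * ∏ s ∈ S, (s + c) := by
      rw [hF, eval_prod, ← Finset.prod_const, ← Finset.prod_mul_distrib]
      refine Finset.prod_congr rfl fun s _ => ?_
      simp only [eval_sub, eval_X, eval_C]
      ring
    rw [this]
    rcases neg_one_pow_eq_or ℤ S.card with e | e <;> simp [e]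
  · have := congrArg (aeval A) hmul
    rw [map_mul, aeval_X_sub_C_eq, map_sub, h.aeval_eq_zero, zero_sub, aeval_C, neg_smul,
      sub_neg_eq_add] at this
    rw [this, neg_smul, Algebra.algebraMap_eq_smul_one]
  · rw [h.reads _ hGdeg.le, ← hGdeg, coeff_natDegree, hGlead]

theorem IsSimpleSpectrum.det_add_eq_zero_iff (h : IsSimpleSpectrum A S x y) (c : ℤ) :
    (A + c • (1 : Matrix m m ℤ)).det = 0 ↔ ∏ s ∈ S, (s + c) = 0 := by
  constructor
  · intro hdet
    obtain ⟨N, M, hM, hN, -⟩ := h.exists_mul_eq c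
    have := congrArg Matrix.det hN
    rw [Matrix.det_mul, hdet, zero_mul, Matrix.det_smul, Matrix.det_one, mul_one] at this
    have hM0 := eq_zero_of_pow_eq_zero this.symm
    rcases hM with hM | hM
    · rw [← hM, hM0]
    · linarith
  · intro hprod
    obtain ⟨s, hs, hs0⟩ := Finset.prod_eq_zero_iff.1 hprod
    have := h.det_eq_zero hs
    rwa [eq_neg_of_add_eq_zero_left hs0, neg_smul, sub_neg_eq_add] at this

/-- The complex eigenvalues of a shift of `A`. -/
theorem IsSimpleSpectrum.hasEigenvalue_iff (h : IsSimpleSpectrum A S x y) (c : ℤ) (μ : ℂ) :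
    Module.End.HasEigenvalue
        (Matrix.toLin' ((A + c • (1 : Matrix m m ℤ)).map (Int.cast : ℤ → ℂ))) μ ↔
      ∃ s ∈ S, ((s + c : ℤ) : ℂ) = μ := by
  constructor
  · intro hμ
    obtain ⟨v, hv⟩ := hμ.exists_hasEigenvector
    let φ : Matrix m m ℤ →+* Module.End ℂ (m → ℂ) :=
      (Matrix.toLinAlgEquiv' : Matrix m m ℂ ≃ₐ[ℂ] _).toRingEquiv.toRingHom.comp
        (Int.castRingHom ℂ).mapMatrix
    have hφ : ∀ B : Matrix m m ℤ, Matrix.toLin' (B.map (Int.cast : ℤ → ℂ)) = φ B := fun B => rfl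
    rw [hφ] at hv
    set p : ℤ[X] := ∏ s ∈ S, (X - C (s + c)) with hp
    have hp0 : aeval (A + c • (1 : Matrix m m ℤ)) p = 0 := by
      have hcomp : p = (∏ s ∈ S, (X - C s)).comp (X - C c) := by
        rw [hp, Polynomial.prod_comp]
        refine Finset.prod_congr rfl fun s _ => ?_
        simp only [map_add, sub_comp, X_comp, C_comp]
        ring
      rw [hcomp, aeval_comp, aeval_X_sub_C_eq, add_sub_cancel_right, h.aeval_eq_zero]
    -- A polynomial that annihilates the operator vanishes at each eigenvalue.
    have h1 := Module.End.aeval_apply_of_hasEigenvector (p := p.map (algebraMap ℤ ℂ)) hv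
    rw [aeval_map_algebraMap, show aeval (φ (A + c • (1 : Matrix m m ℤ))) p =
      φ (aeval (A + c • (1 : Matrix m m ℤ)) p) from
        aeval_algHom_apply φ.toIntAlgHom (A + c • (1 : Matrix m m ℤ)) p, hp0, map_zero,
      LinearMap.zero_apply] at h1
    have h2 := (smul_eq_zero.1 h1.symm).resolve_right hv.2
    rw [eval_map_algebraMap, hp, map_prod] at h2
    obtain ⟨s, hs, hs0⟩ := Finset.prod_eq_zero_iff.1 h2
    refine ⟨s, hs, ?_⟩
    rw [map_sub, aeval_X, aeval_C, sub_eq_zero] at hs0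
    simpa using hs0.symm
  · rintro ⟨s, hs, rfl⟩
    have h1 : ((A - s • (1 : Matrix m m ℤ)).map (Int.cast : ℤ → ℂ)).det = 0 := by
      have := congrArg (Int.cast : ℤ → ℂ) (h.det_eq_zero hs)
      rwa [Int.cast_det, Int.cast_zero] at this
    obtain ⟨v, hv, hv0⟩ := Matrix.exists_mulVec_eq_zero_iff.2 h1
    refine Module.End.hasEigenvalue_of_hasEigenvector (x := v) ⟨?_, hv⟩
    rw [Module.End.mem_eigenspace_iff, Matrix.toLin'_apply]
    have e : (A + c • (1 : Matrix m m ℤ)).map (Int.cast : ℤ → ℂ) =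
        (A - s • (1 : Matrix m m ℤ)).map (Int.cast : ℤ → ℂ) +
          ((s + c : ℤ) : ℂ) • (1 : Matrix m m ℂ) := by
      ext i j
      simp only [Matrix.map_apply, Matrix.add_apply, Matrix.sub_apply, Matrix.smul_apply,
        Matrix.one_apply, smul_eq_mul]
      split_ifs <;> push_cast <;> ring
    rw [e, Matrix.add_mulVec, hv0, zero_add, Matrix.smul_mulVec, Matrix.one_mulVec]

theorem IsSimpleSpectrum.prodDistinctEigenvalues_eq (h : IsSimpleSpectrum A S x y) (c : ℤ) :
    prodDistinctEigenvalues (A + c • (1 : Matrix m m ℤ)) = ((∏ s ∈ S, (s + c) : ℤ) : ℂ) := by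
  rw [prodDistinctEigenvalues, Int.cast_prod]
  symm
  refine Finset.prod_bij
    (fun s hs => ⟨((s + c : ℤ) : ℂ), (h.hasEigenvalue_iff c _).2 ⟨s, hs, rfl⟩⟩) ?_ ?_ ?_ ?_
  · intro s _
    exact Finset.mem_univ _
  · intro s _ t _ hst
    have := Subtype.mk.inj hst
    have : s + c = t + c := by exact_mod_cast this
    omega
  · rintro ⟨μ, hμ⟩ -
    obtain ⟨s, hs, rfl⟩ := (h.hasEigenvalue_iff c _).1 hμ
    exact ⟨s, hs, rfl⟩
  · intro s _
    rfl

theorem IsSimpleSpectrum.isLastSmithInvariant_iff (h : IsSimpleSpectrum A S x y) (c : ℤ) :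
    ((A + c • (1 : Matrix m m ℤ)).det = 0 →
      ∀ s : ℤ, IsLastSmithInvariant (A + c • (1 : Matrix m m ℤ)) s ↔ s = 0) ∧
    ((A + c • (1 : Matrix m m ℤ)).det ≠ 0 →
      ∀ s : ℤ, IsLastSmithInvariant (A + c • (1 : Matrix m m ℤ)) s ↔
        ((s : ℂ) = prodDistinctEigenvalues (A + c • (1 : Matrix m m ℤ)) ∨
          (s : ℂ) = -prodDistinctEigenvalues (A + c • (1 : Matrix m m ℤ)))) := by
  have : Nonempty m := ⟨x⟩
  refine ⟨fun hdet s => isLastSmithInvariant_iff_of_det_eq_zero hdet s, fun hdet s => ?_⟩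
  obtain ⟨N, M, hM, hN, hxy⟩ := h.exists_mul_eq c
  rw [Ne, h.det_add_eq_zero_iff] at hdet
  have hM0 : M ≠ 0 := by
    rcases hM with rfl | rfl
    · exact hdet
    · exact neg_ne_zero.2 hdet
  rw [isLastSmithInvariant_iff_of_mul_eq hM0 hN (x := x) (y := y) (by rw [hxy]; exact isUnit_one),
    h.prodDistinctEigenvalues_eq c]
  norm_cast
  rcases hM with rfl | rfl
  · rfl
  · rw [neg_neg, or_comm]

end Spectrum

/-! ### Nonsingularity of `DU` and strict rank growth -/

section System

variable {P : ℕ → Type*} [∀ n, Fintype (P n)] [∀ n, DecidableEq (P n)]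
  {U : ∀ n, Matrix (P (n + 1)) (P n) ℤ} {r : ℕ}

theorem IsDifferentialSystem.det_transpose_mul_ne_zero (h : IsDifferentialSystem U r) (hr : 1 ≤ r)
    (n : ℕ) : ((U n)ᵀ * U n).det ≠ 0 := by
  obtain ⟨S, x, y, -, hS⟩ := h.exists_spectrum hr n
  rw [h.down_up, Ne, hS.det_add_eq_zero_iff, Finset.prod_eq_zero_iff]
  rintro ⟨s, hs, hs0⟩
  have := hS.nonneg s hs
  omega

/-- The rank sizes of a differential poset increase strictly. -/
theorem IsDifferentialSystem.card_lt (h : IsDifferentialSystem U r) (hr : 1 ≤ r) (n : ℕ) :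
    Fintype.card (P (n + 1)) < Fintype.card (P (n + 2)) := by
  have hne := h.det_transpose_mul_ne_zero hr (n + 1)
  have hdet : (U (n + 1) * (U (n + 1))ᵀ).det = 0 := by
    obtain ⟨S, x, y, h0, hS⟩ := h.exists_spectrum hr (n + 2)
    simpa [ud] using hS.det_eq_zero (h0 (by omega))
  have hle : Fintype.card (P (n + 1)) ≤ Fintype.card (P (n + 2)) := by
    rw [← Matrix.rank_of_det_ne_zero hne]
    exact (Matrix.rank_mul_le_right _ _).trans (Matrix.rank_le_card_height _)
  -- With equal rank sizes `U` becomes a square matrix `V` after relabelling, and `VᵀV`, `VVᵀ` would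
  -- have the same determinant.
  refine lt_of_le_of_ne hle fun heq => hne ?_
  let e := Fintype.equivOfCardEq heq
  set V := (U (n + 1)).submatrix e id with hV
  have h1 : (U (n + 1))ᵀ * U (n + 1) = Vᵀ * V := by
    rw [hV, Matrix.transpose_submatrix, Matrix.submatrix_mul_equiv, Matrix.submatrix_id_id]
  have h2 : (U (n + 1) * (U (n + 1))ᵀ).submatrix e e = V * Vᵀ := by
    ext i j
    simp [hV, Matrix.mul_apply]
  rw [h1, Matrix.det_mul, mul_comm, ← Matrix.det_mul, ← h2, Matrix.det_submatrix_equiv_self, hdet]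

end System

end UpDown

/-! ### The conclusions for differential graded posets -/

namespace GradedPoset

open Matrix

variable (P : Type*) [PartialOrder P] [GradeOrder ℕ P]

theorem downMatrix_eq_transpose (n : ℕ) : downMatrix P n = (upMatrix P n)ᵀ := rfl

variable [∀ n, Finite (Rank P n)]

/-- Strict rank growth and the last Smith invariants of `DU + k` in a differential poset. -/
theorem rankSize_lt_and_isLastSmithInvariant_iff {r : ℕ} (hr : 1 ≤ r)
    (h : UpDown.IsDifferentialSystem (upMatrix P) r) :
    (∀ n : ℕ, 2 ≤ n → rankSize P (n - 1) < rankSize P n) ∧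
      ∀ (n : ℕ) (k : ℤ),
        ((DUAdd P n k).det = 0 → ∀ s : ℤ, IsLastSmithInvariant (DUAdd P n k) s ↔ s = 0) ∧
        ((DUAdd P n k).det ≠ 0 → ∀ s : ℤ, IsLastSmithInvariant (DUAdd P n k) s ↔
          ((s : ℂ) = prodDistinctEigenvalues (DUAdd P n k) ∨
            (s : ℂ) = -prodDistinctEigenvalues (DUAdd P n k))) := by
  constructor
  · intro n hn
    obtain ⟨n, rfl⟩ : ∃ m, n = m + 2 := ⟨n - 2, by omega⟩
    have := h.card_lt hr n
    rwa [← Nat.card_eq_fintype_card, ← Nat.card_eq_fintype_card] at this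
  · intro n k
    obtain ⟨S, x, y, -, hS⟩ := h.exists_spectrum hr n
    have e : DUAdd P n k = UpDown.ud (upMatrix P) n +
        (r + k : ℤ) • (1 : Matrix (Rank P n) (Rank P n) ℤ) := by
      rw [DUAdd, DU, downMatrix_eq_transpose, h.down_up, add_smul, add_assoc]
    rw [e]
    exact hS.isLastSmithInvariant_iff _

end GradedPoset

/-! ### Powers of Young's lattice are differential -/

namespace YoungDiagram

variable {μ ν : YoungDiagram}

theorem exists_cell_of_covBy (h : μ ⋖ ν) : ∃ c, c ∉ μ ∧ ∀ x, x ∈ ν ↔ x = c ∨ x ∈ μ := by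
  have hsub : μ.cells ⊆ ν.cells := cells_subset_iff.2 h.1.le
  have hcard : (ν.cells \ μ.cells).card = 1 := by
    have := YoungPower.card_covBy h
    rw [Finset.card_sdiff_of_subset hsub]
    change ν.cells.card = μ.cells.card + 1 at this
    omega
  obtain ⟨c, hc⟩ := Finset.card_eq_one.1 hcard
  have hx : ∀ x, x ∈ ν.cells \ μ.cells ↔ x = c := fun x => by rw [hc, Finset.mem_singleton]
  simp only [Finset.mem_sdiff, mem_cells] at hx
  refine ⟨c, ((hx c).2 rfl).2, fun x => ⟨fun hxν => ?_, ?_⟩⟩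
  · by_cases hxμ : x ∈ μ
    · exact Or.inr hxμ
    · exact Or.inl ((hx x).1 ⟨hxν, hxμ⟩)
  · rintro (rfl | hxμ)
    · exact ((hx x).2 rfl).1
    · exact hsub hxμ

theorem covBy_of_forall_mem {c : ℕ × ℕ} (hc : c ∉ μ) (h : ∀ x, x ∈ ν ↔ x = c ∨ x ∈ μ) :
    μ ⋖ ν := by
  refine ⟨lt_of_le_of_ne (fun x hx => (h x).2 (Or.inr hx)) ?_, fun κ h1 h2 => ?_⟩
  · rintro rfl
    exact hc ((h c).2 (Or.inl rfl))
  · have hcκ : c ∉ κ := by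
      intro hcκ
      refine absurd (fun x hx => ?_ : ν ≤ κ) h2.not_ge
      rcases (h x).1 hx with rfl | hx
      · exact hcκ
      · exact h1.le hx
    refine absurd (fun x hx => ?_ : κ ≤ μ) h1.not_ge
    rcases (h x).1 (h2.le hx) with rfl | hx'
    · exact absurd hx hcκ
    · exact hx'

/-- The rows that can be lengthened by a box. -/
def addableRows (μ : YoungDiagram) : Set ℕ := {i | ∀ k, i = k + 1 → μ.rowLen i < μ.rowLen k}

/-- The rows that can be shortened by a box. -/
def removableRows (μ : YoungDiagram) : Set ℕ := {i | μ.rowLen (i + 1) < μ.rowLen i}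

/-- Lengthening a row by a box. -/
def addBox (μ : YoungDiagram) (i : μ.addableRows) : YoungDiagram where
  cells := insert (i.1, μ.rowLen i) μ.cells
  isLowerSet := by
    rintro ⟨a, b⟩ ⟨c, d⟩ hle hab
    obtain ⟨h1, h2⟩ := Prod.mk_le_mk.1 hle
    simp only [Finset.coe_insert, Set.mem_insert_iff, Finset.mem_coe, mem_cells,
      mem_iff_lt_rowLen, Prod.mk.injEq] at hab ⊢
    obtain ⟨i, hi⟩ := i
    rcases hab with ⟨rfl, rfl⟩ | hab
    · rcases h2.lt_or_eq with h2 | h2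
      · exact Or.inr (h2.trans_le (μ.rowLen_anti _ _ h1))
      · rcases h1.lt_or_eq with h1 | h1
        · right
          obtain ⟨k, rfl⟩ : ∃ k, a = k + 1 := ⟨a - 1, by omega⟩
          have := hi k rfl
          have := μ.rowLen_anti c k (by omega)
          dsimp only at *
          omega
        · exact Or.inl ⟨h1, h2⟩
    · exact Or.inr (h2.trans_lt (hab.trans_le (μ.rowLen_anti _ _ h1)))

/-- Shortening a row by a box. -/
def removeBox (μ : YoungDiagram) (i : μ.removableRows) : YoungDiagram where
  cells := μ.cells.erase (i.1, μ.rowLen i - 1)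
  isLowerSet := by
    rintro ⟨a, b⟩ ⟨c, d⟩ hle hab
    obtain ⟨h1, h2⟩ := Prod.mk_le_mk.1 hle
    simp only [Finset.coe_erase, Set.mem_sdiff, Finset.mem_coe, mem_cells,
      mem_iff_lt_rowLen, Set.mem_singleton_iff, Prod.mk.injEq] at hab ⊢
    obtain ⟨i, hi⟩ := i
    have hi' : μ.rowLen (i + 1) < μ.rowLen i := hi
    refine ⟨h2.trans_lt (hab.1.trans_le (μ.rowLen_anti _ _ h1)), ?_⟩
    rintro ⟨rfl, rfl⟩
    dsimp only at *
    rcases h1.lt_or_eq with h1 | rfl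
    · have := μ.rowLen_anti (c + 1) a h1
      omega
    · exact hab.2 ⟨rfl, by omega⟩

theorem mem_addBox {i : μ.addableRows} {x : ℕ × ℕ} :
    x ∈ μ.addBox i ↔ x = (i.1, μ.rowLen i) ∨ x ∈ μ := by
  change x ∈ insert (i.1, μ.rowLen i) μ.cells ↔ _
  simp

theorem mem_removeBox {i : μ.removableRows} {x : ℕ × ℕ} :
    x ∈ μ.removeBox i ↔ x ≠ (i.1, μ.rowLen i - 1) ∧ x ∈ μ := by
  change x ∈ μ.cells.erase (i.1, μ.rowLen i - 1) ↔ _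
  simp

theorem covBy_addBox (i : μ.addableRows) : μ ⋖ μ.addBox i :=
  covBy_of_forall_mem (by simp [mem_iff_lt_rowLen]) fun _ => mem_addBox

theorem removeBox_covBy (i : μ.removableRows) : μ.removeBox i ⋖ μ := by
  have hi : μ.rowLen (i.1 + 1) < μ.rowLen i.1 := i.2
  have hmem : (i.1, μ.rowLen i - 1) ∈ μ := mem_iff_lt_rowLen.2 (by omega)
  refine covBy_of_forall_mem (c := (i.1, μ.rowLen i - 1)) (by simp [mem_removeBox]) fun x => ?_
  rw [mem_removeBox]
  by_cases hx : x = (i.1, μ.rowLen i - 1)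
  · simpa [hx] using hmem
  · simp [hx]

/-- The new cell of an upper cover must lie at the end of its row, and the cell above it, if any,
must already belong to `μ`; that is addability of the row. -/
theorem addBox_bijective : Function.Bijective
    (fun i : μ.addableRows => (⟨μ.addBox i, covBy_addBox i⟩ : {ν // μ ⋖ ν})) := by
  constructor
  · intro i j hij
    have h1 : μ.addBox i = μ.addBox j := congrArg Subtype.val hij
    have h2 : ((i.1, μ.rowLen i) : ℕ × ℕ) ∈ μ.addBox j := h1 ▸ mem_addBox.2 (Or.inl rfl)
    rcases mem_addBox.1 h2 with h | h
    · exact Subtype.ext (Prod.mk.inj h).1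
    · exact absurd (mem_iff_lt_rowLen.1 h) (lt_irrefl _)
  · rintro ⟨ν, hν⟩
    obtain ⟨⟨i, j⟩, hc, h⟩ := exists_cell_of_covBy hν
    have hcν : (i, j) ∈ ν := (h _).2 (Or.inl rfl)
    have hj : j = μ.rowLen i := by
      rcases (h (i, μ.rowLen i)).1 (ν.up_left_mem le_rfl
        (not_lt.1 fun hlt => hc (mem_iff_lt_rowLen.2 hlt)) hcν) with h' | h'
      · exact (Prod.mk.inj h').2.symm
      · exact absurd (mem_iff_lt_rowLen.1 h') (lt_irrefl _)
    subst hj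
    have hi : i ∈ μ.addableRows := by
      rintro k rfl
      rcases (h (k, μ.rowLen (k + 1))).1 (ν.up_left_mem (Nat.le_succ k) le_rfl hcν) with h' | h'
      · have := (Prod.mk.inj h').1
        omega
      · exact mem_iff_lt_rowLen.1 h'
    refine ⟨⟨i, hi⟩, Subtype.ext (SetLike.ext fun x => ?_)⟩
    rw [mem_addBox, h]

theorem removeBox_bijective : Function.Bijective
    (fun i : μ.removableRows => (⟨μ.removeBox i, removeBox_covBy i⟩ : {ν // ν ⋖ μ})) := by
  constructor
  · intro i j hij
    have h1 : μ.removeBox i = μ.removeBox j := congrArg Subtype.val hij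
    have hi : μ.rowLen (i.1 + 1) < μ.rowLen i.1 := i.2
    have h2 : ((i.1, μ.rowLen i - 1) : ℕ × ℕ) ∉ μ.removeBox j := by
      rw [← h1, mem_removeBox]
      simp
    by_contra hne
    refine h2 (mem_removeBox.2 ⟨fun h => hne (Subtype.ext (Prod.mk.inj h).1), ?_⟩)
    exact mem_iff_lt_rowLen.2 (by omega)
  · rintro ⟨ν, hν⟩
    obtain ⟨⟨i, j⟩, hc, h⟩ := exists_cell_of_covBy hν
    have hcμ : j < μ.rowLen i := mem_iff_lt_rowLen.1 ((h _).2 (Or.inl rfl))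
    have hj : j = μ.rowLen i - 1 := by
      by_contra hne
      rcases (h (i, j + 1)).1 (mem_iff_lt_rowLen.2 (by omega)) with h' | h'
      · have := (Prod.mk.inj h').2
        omega
      · exact hc (ν.up_left_mem le_rfl (Nat.le_succ j) h')
    have hi : i ∈ μ.removableRows := by
      by_contra hcon
      have hcon' : ¬ μ.rowLen (i + 1) < μ.rowLen i := hcon
      rcases (h (i + 1, j)).1 (mem_iff_lt_rowLen.2 (by omega)) with h' | h'
      · have := (Prod.mk.inj h').1
        omega
      · exact hc (ν.up_left_mem (Nat.le_succ i) le_rfl h')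
    refine ⟨⟨i, hi⟩, Subtype.ext (SetLike.ext fun x => ?_)⟩
    rw [mem_removeBox, h, ← hj]
    by_cases hx : x = (i, j)
    · simp [hx, hc]
    · simp [hx]

/-- Nothing lies above row `0`, and the inequality for lengthening row `i + 1` is the one for
shortening row `i`. This is why Young's lattice is 1-differential. -/
theorem addableRows_eq (μ : YoungDiagram) :
    μ.addableRows = insert 0 (Nat.succ '' μ.removableRows) := by
  ext i
  cases i with
  | zero => simp [addableRows]
  | succ i => simp [addableRows, removableRows]

instance (μ : YoungDiagram) : Finite {ν // ν ⋖ μ} :=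
  ((YoungPower.finite_card_le μ.card).subset fun _ hν =>
    Finset.card_le_card (cells_subset_iff.2 hν.1.le)).to_subtype

theorem finite_removableRows (μ : YoungDiagram) : μ.removableRows.Finite :=
  Set.finite_coe_iff.1 (Finite.of_injective _ removeBox_bijective.1)

instance (μ : YoungDiagram) : Finite {ν // μ ⋖ ν} := by
  have : Finite μ.addableRows := by
    rw [addableRows_eq]
    exact ((μ.finite_removableRows.image _).insert _).to_subtype
  exact Finite.of_surjective _ addBox_bijective.2

/-- A Young diagram has one more upper cover than it has lower covers. -/
theorem card_covBy_eq (μ : YoungDiagram) : Nat.card {ν // μ ⋖ ν} = Nat.card {ν // ν ⋖ μ} + 1 := by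
  rw [← Nat.card_congr (Equiv.ofBijective _ addBox_bijective),
    ← Nat.card_congr (Equiv.ofBijective _ removeBox_bijective), addableRows_eq,
    Nat.card_coe_set_eq, Nat.card_coe_set_eq, Set.ncard_insert_of_notMem (by simp)
      (μ.finite_removableRows.image _), Set.ncard_image_of_injective _ Nat.succ_injective]

end YoungDiagram

/-! ### Covers in products: exactly one coordinate moves, by a cover -/

section Pi

variable {ι : Type*} [DecidableEq ι] {α : ι → Type*}

theorem eq_of_update_eq_update {x : ∀ i, α i} {i j : ι} {a : α i} {b : α j} (ha : a ≠ x i)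
    (h : Function.update x i a = Function.update x j b) :
    (⟨i, a⟩ : Σ i, α i) = ⟨j, b⟩ := by
  by_cases hij : i = j
  · subst hij
    rw [Function.update_injective x i h]
  · have := congrFun h i
    rw [Function.update_self, Function.update_of_ne hij] at this
    exact absurd this ha

variable [∀ i, PartialOrder (α i)]

theorem covBy_update {x : ∀ i, α i} {i : ι} {a : α i} (h : x i ⋖ a) :
    x ⋖ Function.update x i a :=
  Pi.covBy_iff.2 ⟨i, by simpa using h, fun j hj => by simp [hj]⟩

theorem update_covBy {x : ∀ i, α i} {i : ι} {a : α i} (h : a ⋖ x i) :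
    Function.update x i a ⋖ x :=
  Pi.covBy_iff.2 ⟨i, by simpa using h, fun j hj => by simp [hj]⟩

theorem Pi.card_covBy [Fintype ι] (x : ∀ i, α i) [∀ i, Finite {a // x i ⋖ a}] :
    Nat.card {y // x ⋖ y} = ∑ i, Nat.card {a // x i ⋖ a} := by
  rw [← Nat.card_sigma]
  refine (Nat.card_congr (Equiv.ofBijective
    (fun p : Σ i, {a // x i ⋖ a} =>
      (⟨Function.update x p.1 p.2.1, covBy_update p.2.2⟩ : {y // x ⋖ y})) ⟨?_, ?_⟩)).symm
  · rintro ⟨i, a, ha⟩ ⟨j, b, hb⟩ h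
    have := eq_of_update_eq_update ha.1.ne' (congrArg Subtype.val h)
    cases this
    rfl
  · rintro ⟨y, hy⟩
    obtain ⟨i, hi, hj⟩ := Pi.covBy_iff.1 hy
    refine ⟨⟨i, y i, hi⟩, Subtype.ext ?_⟩
    funext j
    by_cases hji : j = i
    · subst hji; simp
    · simp [hji, hj j hji]

theorem Pi.card_covBy' [Fintype ι] (x : ∀ i, α i) [∀ i, Finite {a // a ⋖ x i}] :
    Nat.card {y // y ⋖ x} = ∑ i, Nat.card {a // a ⋖ x i} := by
  rw [← Nat.card_sigma]
  refine (Nat.card_congr (Equiv.ofBijective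
    (fun p : Σ i, {a // a ⋖ x i} =>
      (⟨Function.update x p.1 p.2.1, update_covBy p.2.2⟩ : {y // y ⋖ x})) ⟨?_, ?_⟩)).symm
  · rintro ⟨i, a, ha⟩ ⟨j, b, hb⟩ h
    have := eq_of_update_eq_update ha.1.ne (congrArg Subtype.val h)
    cases this
    rfl
  · rintro ⟨y, hy⟩
    obtain ⟨i, hi, hj⟩ := Pi.covBy_iff.1 hy
    refine ⟨⟨i, y i, hi⟩, Subtype.ext ?_⟩
    funext j
    by_cases hji : j = i
    · subst hji; simp
    · simp [hji, hj j hji]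

end Pi

/-! ### Entries of `UᵀU` and `UUᵀ` as numbers of common covers -/

namespace GradedPoset

open Matrix

variable {P : Type*} [PartialOrder P] [GradeOrder ℕ P]

theorem upMatrix_eq_zero_or_one (n : ℕ) (y : Rank P (n + 1)) (x : Rank P n) :
    upMatrix P n y x = 0 ∨ upMatrix P n y x = 1 := by
  simp only [upMatrix, Matrix.of_apply]
  split_ifs <;> simp

theorem grade_eq_add_one_of_covBy {x y : P} (h : x ⋖ y) : grade ℕ y = grade ℕ x + 1 :=
  (Nat.covBy_iff_add_one_eq.1 (h.grade ℕ)).symm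

variable [∀ n, Finite (Rank P n)]

theorem transpose_mul_upMatrix_apply (n : ℕ) (x y : Rank P n) :
    ((upMatrix P n)ᵀ * upMatrix P n) x y = Nat.card {z : P // x.1 ⋖ z ∧ y.1 ⋖ z} := by
  classical
  have e : {z : Rank P (n + 1) // x.1 ⋖ z.1 ∧ y.1 ⋖ z.1} ≃ {z : P // x.1 ⋖ z ∧ y.1 ⋖ z} :=
    { toFun := fun z => ⟨z.1.1, z.2⟩
      invFun := fun z => ⟨⟨z.1, by rw [grade_eq_add_one_of_covBy z.2.1, x.2]⟩, z.2⟩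
      left_inv := fun _ => rfl
      right_inv := fun _ => rfl }
  rw [← Nat.card_congr e, Nat.card_eq_fintype_card, Fintype.card_subtype, Finset.card_filter,
    Matrix.mul_apply]
  push_cast
  refine Finset.sum_congr rfl fun z _ => ?_
  simp only [Matrix.transpose_apply, upMatrix, Matrix.of_apply]
  by_cases h1 : x.1 ⋖ z.1 <;> by_cases h2 : y.1 ⋖ z.1 <;> simp [h1, h2]

theorem upMatrix_mul_transpose_apply (n : ℕ) (x y : Rank P (n + 1)) :
    (upMatrix P n * (upMatrix P n)ᵀ) x y = Nat.card {z : P // z ⋖ x.1 ∧ z ⋖ y.1} := by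
  classical
  have e : {z : Rank P n // z.1 ⋖ x.1 ∧ z.1 ⋖ y.1} ≃ {z : P // z ⋖ x.1 ∧ z ⋖ y.1} :=
    { toFun := fun z => ⟨z.1.1, z.2⟩
      invFun := fun z => ⟨⟨z.1, by
        have := grade_eq_add_one_of_covBy z.2.1
        rw [x.2] at this
        exact (Nat.succ.inj this).symm⟩, z.2⟩
      left_inv := fun _ => rfl
      right_inv := fun _ => rfl }
  rw [← Nat.card_congr e, Nat.card_eq_fintype_card, Fintype.card_subtype, Finset.card_filter,
    Matrix.mul_apply]
  push_cast
  refine Finset.sum_congr rfl fun z _ => ?_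
  simp only [Matrix.transpose_apply, upMatrix, Matrix.of_apply]
  by_cases h1 : z.1 ⋖ x.1 <;> by_cases h2 : z.1 ⋖ y.1 <;> simp [h1, h2]

end GradedPoset

/-- Distinct elements of a modular lattice have as many common upper covers as common lower
covers. -/
theorem card_common_covBy {L : Type*} [Lattice L] [IsModularLattice L] {x y : L} (hxy : x ≠ y) :
    Nat.card {z : L // x ⋖ z ∧ y ⋖ z} = Nat.card {z : L // z ⋖ x ∧ z ⋖ y} := by
  have h1 : ∀ z, x ⋖ z → y ⋖ z → z = x ⊔ y := fun z hx hy =>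
    (hx.wcovBy.sup_eq hy.wcovBy hxy).symm
  have h2 : ∀ z, z ⋖ x → z ⋖ y → z = x ⊓ y := fun z hx hy =>
    (hx.wcovBy.inf_eq hy.wcovBy hxy).symm
  -- Both counts are 0 or 1, as only the join and the meet can occur; by modularity they occur
  -- together.
  by_cases h : x ⋖ x ⊔ y ∧ y ⋖ x ⊔ y
  · have h' : x ⊓ y ⋖ x ∧ x ⊓ y ⋖ y :=
      ⟨inf_covBy_of_covBy_sup_right h.2, inf_covBy_of_covBy_sup_left h.1⟩
    have : Unique {z : L // x ⋖ z ∧ y ⋖ z} :=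
      ⟨⟨⟨x ⊔ y, h⟩⟩, fun z => Subtype.ext (h1 z.1 z.2.1 z.2.2)⟩
    have : Unique {z : L // z ⋖ x ∧ z ⋖ y} :=
      ⟨⟨⟨x ⊓ y, h'⟩⟩, fun z => Subtype.ext (h2 z.1 z.2.1 z.2.2)⟩
    rw [Nat.card_unique, Nat.card_unique]
  · have : IsEmpty {z : L // x ⋖ z ∧ y ⋖ z} :=
      ⟨fun z => h (h1 z.1 z.2.1 z.2.2 ▸ z.2)⟩
    have : IsEmpty {z : L // z ⋖ x ∧ z ⋖ y} := by
      refine ⟨fun z => h ?_⟩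
      have hz := z.2
      rw [h2 z.1 z.2.1 z.2.2] at hz
      exact ⟨covBy_sup_of_inf_covBy_right hz.2, covBy_sup_of_inf_covBy_left hz.1⟩
    rw [Nat.card_of_isEmpty, Nat.card_of_isEmpty]

/-! ### The differential relation for powers of Young's lattice -/

namespace YoungPower

open Matrix GradedPoset

variable {r : ℕ}

theorem card_covBy_eq (x : YoungPower r) :
    Nat.card {y // x ⋖ y} = Nat.card {y // y ⋖ x} + r := by
  rw [Pi.card_covBy, Pi.card_covBy', Finset.sum_congr rfl fun i _ =>
    YoungDiagram.card_covBy_eq (x i), Finset.sum_add_distrib]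
  simp

theorem grade_bot : grade ℕ (⊥ : YoungPower r) = 0 := by
  change ∑ i, ((⊥ : YoungPower r) i).card = 0
  simp [YoungDiagram.card]

theorem eq_bot_of_grade {x : YoungPower r} (h : grade ℕ x = 0) : x = ⊥ := by
  by_contra hne
  have := grade_strictMono (𝕆 := ℕ) (bot_lt_iff_ne_bot.2 hne)
  omega

/-- Powers of Young's lattice are differential posets. -/
theorem isDifferentialSystem (r : ℕ) :
    UpDown.IsDifferentialSystem (upMatrix (YoungPower r)) r where
  zero_or_one := upMatrix_eq_zero_or_one
  nonempty := ⟨⟨⊥, grade_bot⟩⟩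
  subsingleton := ⟨fun x y => Subtype.ext ((eq_bot_of_grade x.2).trans (eq_bot_of_grade y.2).symm)⟩
  not_minimal y := by
    refine ⟨⟨⊥, grade_bot⟩, ?_⟩
    have hne : y.1 ≠ ⊥ := by
      intro h
      have := y.2
      rw [h, grade_bot] at this
      exact zero_ne_one this
    have : (⊥ : YoungPower r) ⋖ y.1 := by
      rw [covBy_iff_lt_covBy_grade (𝕆 := ℕ), grade_bot, y.2]
      exact ⟨bot_lt_iff_ne_bot.2 hne, Order.covBy_add_one 0⟩
    exact if_pos this
  zero := by
    ext x y
    have hx := eq_bot_of_grade x.2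
    have hy := eq_bot_of_grade y.2
    obtain rfl : x = y := Subtype.ext (hx.trans hy.symm)
    rw [transpose_mul_upMatrix_apply, Matrix.smul_apply, Matrix.one_apply_eq]
    simp only [and_self]
    rw [card_covBy_eq, hx]
    have : IsEmpty {y : YoungPower r // y ⋖ ⊥} := ⟨fun y => not_lt_bot y.2.1⟩
    simp
  succ n := by
    ext x y
    rw [Matrix.add_apply, transpose_mul_upMatrix_apply, upMatrix_mul_transpose_apply,
      Matrix.smul_apply]
    by_cases hxy : x = y
    · subst hxy
      simp only [and_self]
      rw [card_covBy_eq, Matrix.one_apply_eq]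
      simp
    · rw [Matrix.one_apply_ne hxy, card_common_covBy fun h => hxy (Subtype.ext h)]
      simp

end YoungPower

/-! ### Irreducible characters span the class functions -/

section Characters

open Representation

open scoped MonoidAlgebra

variable {G : Type*} [Group G]

theorem Representation.IsIrreducible.of_equiv {k V W : Type*} [Field k] [AddCommGroup V]
    [Module k V] [AddCommGroup W] [Module k W] {ρ : Representation k G V}
    {σ : Representation k G W} (φ : ρ.Equiv σ) (h : ρ.IsIrreducible) : σ.IsIrreducible := by
  rw [irreducible_iff_isSimpleModule_asModule] at h ⊢
  have hbij : Function.Bijective (IntertwiningMap.equivLinearMapAsModule ρ σ φ.toIntertwiningMap) :=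
    φ.toLinearEquiv.bijective
  exact IsSimpleModule.congr (LinearEquiv.ofBijective _ hbij).symm

theorem asAlgebraHom_ofModule' {k : Type*} [CommSemiring k] (M : Type*) [AddCommMonoid M]
    [Module k M] [Module k[G] M] [IsScalarTower k k[G] M] :
    (ofModule' (k := k) (G := G) M).asAlgebraHom = Algebra.lsmul k k M := by
  simp [asAlgebraHom, ofModule']

theorem isIrreducible_ofModule' {k : Type*} [Field k] (M : Type*) [AddCommGroup M]
    [Module k M] [Module k[G] M] [IsScalarTower k k[G] M] [IsSimpleModule k[G] M] :
    (ofModule' (k := k) (G := G) M).IsIrreducible := by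
  rw [irreducible_iff_isSimpleModule_asModule]
  let φ : (ofModule' (k := k) (G := G) M).asModule ≃ₗ[k[G]] M :=
    { (ofModule' (k := k) (G := G) M).asModuleEquiv.toAddEquiv with
      map_smul' := fun x m => by
        change (ofModule' (k := k) (G := G) M).asModuleEquiv (x • m) = _
        rw [asModuleEquiv_map_smul, asAlgebraHom_ofModule']
        rfl }
  exact IsSimpleModule.congr φ

/-- `Irr` admits only representations on `Fin d → ℂ`; a basis of `W` transports the action there. -/
theorem character_mem_Irr {W : Type*} [AddCommGroup W] [Module ℂ W] [FiniteDimensional ℂ W]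
    (ρ : Representation ℂ G W) (h : ρ.IsIrreducible) : ρ.character ∈ Irr G := by
  let b : W ≃ₗ[ℂ] (Fin (Module.finrank ℂ W) → ℂ) := (Module.finBasis ℂ W).equivFun
  let σ : Representation ℂ G (Fin (Module.finrank ℂ W) → ℂ) :=
    { toFun := fun g => b.conj (ρ g)
      map_one' := by simp [LinearEquiv.conj_apply, Module.End.one_eq_id]
      map_mul' := fun g g' => by simp [Module.End.mul_eq_comp, LinearEquiv.conj_comp] }
  have φ : ρ.Equiv σ := Representation.Equiv.mk b fun g => by
    ext w
    simp [σ, LinearEquiv.conj_apply]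
  exact ⟨_, σ, h.of_equiv φ, char_iso φ⟩

theorem Irr.apply_conj {χ : G → ℂ} (hχ : χ ∈ Irr G) (g h : G) : χ (h * g * h⁻¹) = χ g := by
  obtain ⟨d, ρ, -, rfl⟩ := hχ
  exact char_conj ρ g h

theorem Irr.apply_one_ne_zero {χ : G → ℂ} (hχ : χ ∈ Irr G) : χ 1 ≠ 0 := by
  obtain ⟨d, ρ, hρ, rfl⟩ := hχ
  rw [char_one]
  have := (irreducible_iff_isSimpleModule_asModule ρ).1 hρ
  have : Nontrivial (Fin d → ℂ) := IsSimpleModule.nontrivial ℂ[G] ρ.asModule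
  exact_mod_cast (Module.finrank_pos (R := ℂ) (M := Fin d → ℂ)).ne'

theorem resChar_conj {H : Type*} [Group H] (ι : H →* G) {f : G → ℂ} (hf : ∀ g h, f (h * g * h⁻¹) = f g) (g h : H) :
    resChar ι f (h * g * h⁻¹) = resChar ι f g := by
  simp [resChar, hf]

theorem resChar_sum {H κ : Type*} [Group H] (ι : H →* G) (s : Finset κ) (a : κ → ℂ) (f : κ → G → ℂ) :
    resChar ι (∑ i ∈ s, a i • f i) = ∑ i ∈ s, a i • resChar ι (f i) := by
  funext h
  simp [resChar]

variable [Fintype G]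

theorem charPairing_comm (f h : G → ℂ) : charPairing f h = charPairing h f := by
  rw [charPairing, charPairing, ← Equiv.sum_comp (Equiv.inv G)]
  simp [mul_comm]

theorem charPairing_sum_left {ι : Type*} (s : Finset ι) (a : ι → ℂ) (f : ι → G → ℂ) (h : G → ℂ) :
    charPairing (∑ i ∈ s, a i • f i) h = ∑ i ∈ s, a i * charPairing (f i) h := by
  simp only [charPairing, Finset.sum_apply, Pi.smul_apply, smul_eq_mul, Finset.sum_mul,
    Finset.mul_sum]
  rw [Finset.sum_comm]
  refine Finset.sum_congr rfl fun i _ => Finset.sum_congr rfl fun g _ => ?_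
  ring

theorem charPairing_sub_left (f f' h : G → ℂ) :
    charPairing (f - f') h = charPairing f h - charPairing f' h := by
  simp [charPairing, sub_mul, Finset.sum_sub_distrib, mul_sub]

theorem charPairing_nsmul_left (n : ℕ) (f h : G → ℂ) :
    charPairing (n • f) h = n * charPairing f h := by
  simp only [charPairing, Pi.smul_apply, nsmul_eq_mul, Finset.mul_sum]
  refine Finset.sum_congr rfl fun g _ => ?_
  ring

open Classical in
theorem charPairing_irr (χ ψ : Irr G) : charPairing χ.1 ψ.1 = if χ = ψ then 1 else 0 := by
  have : Invertible (Nat.card G : ℂ) :=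
    invertibleOfNonzero (by exact_mod_cast Nat.card_pos.ne')
  obtain ⟨χ, d, ρ, hρ, rfl⟩ := χ
  obtain ⟨ψ, d', σ, hσ, rfl⟩ := ψ
  have h := char_orthonormal ρ σ
  change charPairing ρ.character σ.character = _ at h
  rw [h]
  by_cases hE : Nonempty (Representation.Equiv σ ρ)
  · rw [if_pos hE, if_pos (Subtype.ext (char_iso hE.some).symm)]
  · rw [if_neg hE, if_neg]
    -- Nonisomorphic irreducibles cannot share a character: its pairing with itself would be both 0
    -- and 1.
    intro he
    have e : ρ.character = σ.character := congrArg Subtype.val he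
    have h1 := char_orthonormal σ σ
    change charPairing σ.character σ.character = _ at h1
    rw [if_neg hE, e, h1, if_pos ⟨Representation.Equiv.refl σ⟩] at h
    exact one_ne_zero h

/-- A class function orthogonal to an irreducible character acts by zero on the representation. -/
theorem sum_smul_eq_zero_of_charPairing {W : Type*} [AddCommGroup W] [Module ℂ W]
    [FiniteDimensional ℂ W] (ρ : Representation ℂ G W) (h : ρ.IsIrreducible) {f : G → ℂ}
    (hf : ∀ g h, f (h * g * h⁻¹) = f g) (h0 : charPairing f ρ.character = 0) :
    ∑ g, f g • ρ g⁻¹ = 0 := by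
  set T : W →ₗ[ℂ] W := ∑ g, f g • ρ g⁻¹ with hT
  have hcomm : ∀ (x : G) (v : W), T (ρ x v) = ρ x (T v) := by
    intro x v
    simp only [hT, LinearMap.sum_apply, LinearMap.smul_apply, map_sum, map_smul]
    rw [← Equiv.sum_comp (MulAut.conj x).toEquiv]
    refine Finset.sum_congr rfl fun g _ => ?_
    simp only [MulEquiv.toEquiv_eq_coe, EquivLike.coe_coe, MulAut.conj_apply, hf]
    rw [← Module.End.mul_apply, ← map_mul, ← Module.End.mul_apply, ← map_mul]
    congr 3
    group
  have := h
  obtain ⟨c, hc⟩ := (IsIrreducible.algebraMap_intertwiningMap_bijective_of_isAlgClosed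
    (ρ := ρ)).2 (T.intertwiningMap_of_isIntertwiningMap ρ ρ hcomm)
  have hTc : T = c • LinearMap.id := by
    have := congrArg IntertwiningMap.toLinearMap hc
    exact this.symm
  -- By Schur's lemma `T` is a scalar, and its trace is `|G|` times the vanishing pairing.
  have htr : LinearMap.trace ℂ W T = 0 := by
    have hcard : (Nat.card G : ℂ) ≠ 0 := by exact_mod_cast Nat.card_pos.ne'
    rw [charPairing, mul_eq_zero, inv_eq_zero] at h0
    rw [hT, map_sum, ← h0.resolve_left hcard]
    refine Finset.sum_congr rfl fun g _ => ?_
    rw [map_smul]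
    rfl
  have hnt : Nontrivial W := by
    have := (irreducible_iff_isSimpleModule_asModule ρ).1 h
    exact IsSimpleModule.nontrivial ℂ[G] ρ.asModule
  rw [hTc, map_smul, LinearMap.trace_id, smul_eq_mul, mul_eq_zero] at htr
  have hd : (Module.finrank ℂ W : ℂ) ≠ 0 := by
    exact_mod_cast (Module.finrank_pos (R := ℂ) (M := W)).ne'
  rw [hTc, htr.resolve_right hd, zero_smul]

/-- A class function orthogonal to all irreducible characters vanishes. -/
theorem eq_zero_of_charPairing_eq_zero {f : G → ℂ} (hf : ∀ g h, f (h * g * h⁻¹) = f g)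
    (h0 : ∀ χ ∈ Irr G, charPairing f χ = 0) : f = 0 := by
  classical
  have : NeZero (Nat.card G : ℂ) := ⟨by exact_mod_cast Nat.card_pos.ne'⟩
  -- Multiplication by `e` on a minimal left ideal is the operator of the preceding lemma, hence
  -- zero. The group algebra is the sum of such ideals, so `e = e * 1 = 0`.
  set e : ℂ[G] := ∑ g, MonoidAlgebra.single g⁻¹ (f g) with he
  have hM : ∀ M : Submodule ℂ[G] ℂ[G], IsSimpleModule ℂ[G] M → ∀ m ∈ M, e * m = 0 := by
    intro M hsimple m hm
    have hirr := isIrreducible_ofModule' (k := ℂ) (G := G) M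
    have : Module.Finite ℂ ℂ[G] := Module.Finite.of_basis (MonoidAlgebra.basis G ℂ)
    have : FiniteDimensional ℂ M := Module.Finite.trans ℂ[G] M
    have hz := sum_smul_eq_zero_of_charPairing _ hirr hf (h0 _ (character_mem_Irr _ hirr))
    have h1 : (ofModule' (k := ℂ) (G := G) M).asAlgebraHom e = 0 := by
      rw [he, map_sum]
      refine (Finset.sum_congr rfl fun g _ => ?_).trans hz
      rw [asAlgebraHom_single]
    rw [asAlgebraHom_ofModule'] at h1
    exact congrArg Subtype.val (LinearMap.congr_fun h1 ⟨m, hm⟩)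
  have htop : sSup {M : Submodule ℂ[G] ℂ[G] | IsSimpleModule ℂ[G] M} = ⊤ :=
    IsSemisimpleModule.sSup_simples_eq_top ℂ[G] ℂ[G]
  have hall : ∀ m : ℂ[G], e * m = 0 := by
    intro m
    have hm : m ∈ sSup {M : Submodule ℂ[G] ℂ[G] | IsSimpleModule ℂ[G] M} := htop ▸ Submodule.mem_top
    rw [sSup_eq_iSup'] at hm
    refine Submodule.iSup_induction _ (motive := fun m => e * m = 0) hm ?_ (mul_zero e) ?_
    · rintro ⟨M, hs⟩ m hm
      exact hM M hs m hm
    · intro a b ha hb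
      rw [mul_add, ha, hb, add_zero]
  have he0 : e = 0 := by simpa using hall 1
  funext h
  have := congrArg (fun x : ℂ[G] => x.coeff h⁻¹) he0
  simp only [he, MonoidAlgebra.coeff_sum, MonoidAlgebra.coeff_single, Finsupp.coe_finsetSum,
    Finset.sum_apply, Finsupp.single_apply, inv_inj] at this
  simpa using this

/-- A class function is the combination of the irreducible characters given by its pairings. -/
theorem eq_sum_charPairing [Fintype (Irr G)] {f : G → ℂ} (hf : ∀ g h, f (h * g * h⁻¹) = f g) :
    f = ∑ χ : Irr G, charPairing f χ.1 • χ.1 := by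
  classical
  rw [← sub_eq_zero]
  refine eq_zero_of_charPairing_eq_zero (fun g h => ?_) fun ψ hψ => ?_
  · simp only [Pi.sub_apply, Finset.sum_apply, Pi.smul_apply, hf, Irr.apply_conj (Subtype.prop _)]
  · rw [charPairing_sub_left, charPairing_sum_left]
    simp [show ∀ χ : Irr G, charPairing χ.1 ψ = _ from fun χ => charPairing_irr χ ⟨ψ, hψ⟩]

theorem charPairing_eq_sum [Fintype (Irr G)] {f : G → ℂ} (hf : ∀ g h, f (h * g * h⁻¹) = f g)
    (h : G → ℂ) : charPairing f h = ∑ χ : Irr G, charPairing f χ.1 * charPairing χ.1 h := by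
  conv_lhs => rw [eq_sum_charPairing hf]
  rw [charPairing_sum_left]

variable {H : Type*} [Group H] [Fintype H] (ι : H →* G)

theorem indChar_conj (f : H → ℂ) (g y : G) : indChar ι f (y * g * y⁻¹) = indChar ι f g := by
  classical
  simp only [indChar]
  congr 1
  rw [← Equiv.sum_comp (Equiv.mulLeft y)]
  refine Finset.sum_congr rfl fun x _ => Finset.sum_congr rfl fun h _ => ?_
  have : (y * x)⁻¹ * (y * g * y⁻¹) * (y * x) = x⁻¹ * g * x := by group
  simp only [Equiv.coe_mulLeft, this]

/-- Frobenius reciprocity. -/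
theorem charPairing_indChar (f : H → ℂ) {ψ : G → ℂ} (hψ : ∀ g h, ψ (h * g * h⁻¹) = ψ g) :
    charPairing (indChar ι f) ψ = charPairing f (resChar ι ψ) := by
  classical
  have hG : (Nat.card G : ℂ) ≠ 0 := by exact_mod_cast Nat.card_pos.ne'
  simp only [charPairing, indChar, resChar]
  have e : ∀ g : G, ((Nat.card H : ℂ)⁻¹ * ∑ x : G, ∑ h : H,
      if x⁻¹ * g * x = ι h then f h else 0) * ψ g⁻¹ =
      (Nat.card H : ℂ)⁻¹ * ∑ x : G, ∑ h : H,
        if x⁻¹ * g * x = ι h then f h * ψ (ι h⁻¹) else 0 := by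
    intro g
    rw [mul_assoc, Finset.sum_mul]
    congr 1
    refine Finset.sum_congr rfl fun x _ => ?_
    rw [Finset.sum_mul]
    refine Finset.sum_congr rfl fun h _ => ?_
    split_ifs with hx
    · rw [map_inv, ← hx, ← hψ g⁻¹ x⁻¹]
      congr 2
      group
    · rw [zero_mul]
  rw [Finset.sum_congr rfl fun g _ => e g, ← Finset.mul_sum, Finset.sum_comm]
  have e2 : ∀ x : G, ∑ g : G, ∑ h : H,
      (if x⁻¹ * g * x = ι h then f h * ψ (ι h⁻¹) else 0) = ∑ h : H, f h * ψ (ι h⁻¹) := by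
    intro x
    rw [Finset.sum_comm]
    refine Finset.sum_congr rfl fun h _ => ?_
    have : ∀ g : G, x⁻¹ * g * x = ι h ↔ g = x * ι h * x⁻¹ := fun g => by
      constructor
      · intro hg; rw [← hg]; group
      · rintro rfl; group
    simp [this]
  rw [Finset.sum_congr rfl fun x _ => e2 x, Finset.sum_const, Finset.card_univ,
    ← Nat.card_eq_fintype_card, nsmul_eq_mul]
  field_simp

theorem charPairing_indChar_irr (χ : H → ℂ) {ψ : G → ℂ} (hψ : ψ ∈ Irr G) :
    charPairing (indChar ι χ) ψ = charPairing (resChar ι ψ) χ := by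
  rw [charPairing_indChar ι χ fun g h => Irr.apply_conj hψ g h, charPairing_comm]

/-- The matrix of `Res Ind` in the basis of irreducible characters. -/
theorem charPairing_resChar_indChar [Fintype (Irr G)] (χ χ' : H → ℂ) :
    charPairing (resChar ι (indChar ι χ')) χ =
      ∑ ψ : Irr G, charPairing (resChar ι ψ.1) χ * charPairing (resChar ι ψ.1) χ' := by
  rw [eq_sum_charPairing (f := indChar ι χ') fun g h => indChar_conj ι χ' g h, resChar_sum,
    charPairing_sum_left]
  refine Finset.sum_congr rfl fun ψ _ => ?_
  rw [charPairing_indChar_irr ι χ' ψ.2, mul_comm]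

/-- The matrix of `Ind Res` in the basis of irreducible characters. -/
theorem charPairing_indChar_resChar [Fintype (Irr H)] {ψ : G → ℂ} (hψ : ψ ∈ Irr G)
    (ψ' : G → ℂ) :
    charPairing (indChar ι (resChar ι ψ')) ψ =
      ∑ χ : Irr H, charPairing (resChar ι ψ) χ.1 * charPairing (resChar ι ψ') χ.1 := by
  rw [charPairing_indChar_irr ι _ hψ, charPairing_eq_sum (resChar_conj ι (Irr.apply_conj hψ))]
  refine Finset.sum_congr rfl fun χ _ => ?_
  rw [charPairing_comm χ.1]

end Characters

/-! ### Posets of differential towers of groups -/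

namespace GroupTower

universe v

open Matrix GradedPoset

variable (T : GroupTower.{v})

theorem branch_iff {n : ℕ} {χ : Irr (T.G n)} {ψ : Irr (T.G (n + 1))} :
    T.Branch ⟨n, χ⟩ ⟨n + 1, ψ⟩ ↔ T.branching n χ.1 ψ.1 ≠ 0 := by
  constructor
  · rintro ⟨_, _, _, h⟩
    exact h
  · exact Branch.intro n χ ψ

/-- Every branching step raises the rank by exactly one, so no generating relation can be refined.
-/
theorem covBy_iff_branch {x y : T.Poset} : x ⋖ y ↔ T.Branch x y := by
  constructor
  · intro h
    rcases Relation.ReflTransGen.cases_head (show Relation.ReflTransGen T.Branch x y from h.le) with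
      h1 | ⟨c, h1, h2⟩
    · exact absurd h1 h.ne
    · rcases eq_or_fst_lt h2 with rfl | h3
      · exact h1
      · have h4 : y.1 = x.1 + 1 := (Nat.covBy_iff_add_one_eq.1 (h.grade ℕ)).symm
        have := h1.fst_eq
        omega
  · intro h
    have hle : x ≤ y := Relation.ReflTransGen.single h
    have hlt : x < y := lt_of_le_of_ne hle fun he => by
      have := h.fst_eq
      rw [he] at this
      omega
    refine (covBy_iff_lt_covBy_grade (𝕆 := ℕ)).2 ⟨hlt, Nat.covBy_iff_add_one_eq.2 ?_⟩
    exact h.fst_eq.symm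

/-- The elements of rank `n` are the irreducible characters of `G_n`. -/
noncomputable def irrEquivRank (n : ℕ) : Irr (T.G n) ≃ Rank T.Poset n :=
  Equiv.ofBijective (fun χ => ⟨⟨n, χ⟩, rfl⟩) <| by
    constructor
    · intro χ ψ h
      have := congrArg Subtype.val h
      cases this
      rfl
    · rintro ⟨⟨m, χ⟩, h⟩
      obtain rfl : m = n := h
      exact ⟨χ, rfl⟩

variable {T} {r : ℕ}

/-- Multiplicity-freeness enters here: a multiplicity that is 0 or 1 equals the indicator of a
cover. -/
theorem IsDifferential.upMatrix_apply (h : T.IsDifferential r) (n : ℕ) (ψ : Irr (T.G (n + 1)))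
    (χ : Irr (T.G n)) :
    ((upMatrix T.Poset n (T.irrEquivRank (n + 1) ψ) (T.irrEquivRank n χ) : ℤ) : ℂ) =
      charPairing (resChar (T.ι n) ψ.1) χ.1 := by
  have hc : (T.irrEquivRank n χ).1 ⋖ (T.irrEquivRank (n + 1) ψ).1 ↔ T.branching n χ.1 ψ.1 ≠ 0 :=
    (covBy_iff_branch T).trans (branch_iff T)
  change _ = T.branching n χ.1 ψ.1
  simp only [upMatrix, Matrix.of_apply, hc]
  rcases h.multiplicityFree n χ.1 χ.2 ψ.1 ψ.2 with e | e <;> simp [e]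

theorem IsDifferential.transpose_mul_apply (h : T.IsDifferential r) (n : ℕ) (χ χ' : Irr (T.G n)) :
    ((((upMatrix T.Poset n)ᵀ * upMatrix T.Poset n) (T.irrEquivRank n χ) (T.irrEquivRank n χ') :
      ℤ) : ℂ) = charPairing (resChar (T.ι n) (indChar (T.ι n) χ'.1)) χ.1 := by
  have : Fintype (Irr (T.G (n + 1))) := Fintype.ofFinite _
  rw [charPairing_resChar_indChar, Matrix.mul_apply, Int.cast_sum,
    ← Equiv.sum_comp (T.irrEquivRank (n + 1))]
  refine Finset.sum_congr rfl fun ψ _ => ?_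
  rw [Matrix.transpose_apply, Int.cast_mul, h.upMatrix_apply, h.upMatrix_apply]

theorem IsDifferential.mul_transpose_apply (h : T.IsDifferential r) (n : ℕ)
    (ψ ψ' : Irr (T.G (n + 1))) :
    (((upMatrix T.Poset n * (upMatrix T.Poset n)ᵀ) (T.irrEquivRank (n + 1) ψ)
      (T.irrEquivRank (n + 1) ψ') : ℤ) : ℂ) =
      charPairing (indChar (T.ι n) (resChar (T.ι n) ψ'.1)) ψ.1 := by
  have : Fintype (Irr (T.G n)) := Fintype.ofFinite _
  rw [charPairing_indChar_resChar _ ψ.2, Matrix.mul_apply, Int.cast_sum,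
    ← Equiv.sum_comp (T.irrEquivRank n)]
  refine Finset.sum_congr rfl fun χ _ => ?_
  rw [Matrix.transpose_apply, Int.cast_mul, h.upMatrix_apply, h.upMatrix_apply]

theorem smul_one_apply (n : ℕ) (χ χ' : Irr (T.G n)) :
    ((((r : ℤ) • (1 : Matrix (Rank T.Poset n) (Rank T.Poset n) ℤ)) (T.irrEquivRank n χ)
      (T.irrEquivRank n χ') : ℤ) : ℂ) = charPairing (r • χ'.1) χ.1 := by
  classical
  rw [charPairing_nsmul_left, charPairing_irr, Matrix.smul_apply, Matrix.one_apply]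
  simp [eq_comm]

/-- The poset of an `r`-differential tower of groups is an `r`-differential poset. -/
theorem IsDifferential.isDifferentialSystem (h : T.IsDifferential r) :
    UpDown.IsDifferentialSystem (upMatrix T.Poset) r where
  zero_or_one := upMatrix_eq_zero_or_one
  nonempty := by
    by_contra hempty
    have h1 : (1 : T.G 0 → ℂ) = 0 := eq_zero_of_charPairing_eq_zero (fun _ _ => rfl)
      fun χ hχ => absurd ⟨T.irrEquivRank 0 ⟨χ, hχ⟩⟩ hempty
    exact one_ne_zero (congrFun h1 1)
  subsingleton := by
    classical
    have := T.subsingleton_zero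
    have : Subsingleton (Irr (T.G 0)) := by
      refine ⟨fun χ ψ => ?_⟩
      -- On the trivial group the pairing of two irreducible characters is a product of nonzero
      -- values at `1`, against orthogonality.
      by_contra hne
      have h1 := charPairing_irr χ ψ
      rw [if_neg hne, charPairing, Fintype.sum_subsingleton _ (1 : T.G 0), inv_one] at h1
      simp [Irr.apply_one_ne_zero χ.2, Irr.apply_one_ne_zero ψ.2] at h1
    exact (T.irrEquivRank 0).symm.subsingleton
  not_minimal y := by
    obtain ⟨ψ, rfl⟩ := (T.irrEquivRank 1).surjective y
    by_contra hcon
    -- Without a constituent the restriction would vanish, but its value at `1` is that of `ψ`,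
    -- which is nonzero.
    have h1 : resChar (T.ι 0) ψ.1 = 0 := by
      refine eq_zero_of_charPairing_eq_zero (resChar_conj _ (Irr.apply_conj ψ.2)) fun χ hχ => ?_
      rw [← h.upMatrix_apply 0 ψ ⟨χ, hχ⟩, Int.cast_eq_zero]
      exact (upMatrix_eq_zero_or_one _ _ _).resolve_right fun he => hcon ⟨_, he⟩
    have h2 := congrFun h1 1
    rw [resChar, map_one] at h2
    exact Irr.apply_one_ne_zero ψ.2 h2
  zero := by
    ext x y
    obtain ⟨χ, rfl⟩ := (T.irrEquivRank 0).surjective x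
    obtain ⟨χ', rfl⟩ := (T.irrEquivRank 0).surjective y
    have : ((_ : ℤ) : ℂ) = _ := h.transpose_mul_apply 0 χ χ'
    rw [h.res_ind_zero _ (Submodule.subset_span χ'.2), ← smul_one_apply] at this
    exact_mod_cast this
  succ n := by
    ext x y
    obtain ⟨χ, rfl⟩ := (T.irrEquivRank (n + 1)).surjective x
    obtain ⟨χ', rfl⟩ := (T.irrEquivRank (n + 1)).surjective y
    have h1 := h.transpose_mul_apply (n + 1) χ χ'
    have h2 := h.mul_transpose_apply n χ χ'
    have h3 := smul_one_apply (T := T) (r := r) (n + 1) χ χ'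
    rw [← h.res_ind_succ n _ (Submodule.subset_span χ'.2), charPairing_sub_left, ← h1, ← h2] at h3
    rw [Matrix.add_apply]
    have h4 := add_eq_of_eq_sub' h3
    exact_mod_cast h4.symm

end GroupTower

theorem corollary6p13 (r : ℕ) (hr : 1 ≤ r) :
    (∀ T : GroupTower.{u}, T.IsDifferential r →
      (∀ n : ℕ, 2 ≤ n → GradedPoset.rankSize T.Poset (n - 1) < GradedPoset.rankSize T.Poset n) ∧
      ∀ (n : ℕ) (k : ℤ),
        ((GradedPoset.DUAdd T.Poset n k).det = 0 →
          ∀ s : ℤ, IsLastSmithInvariant (GradedPoset.DUAdd T.Poset n k) s ↔ s = 0) ∧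
        ((GradedPoset.DUAdd T.Poset n k).det ≠ 0 →
          ∀ s : ℤ, IsLastSmithInvariant (GradedPoset.DUAdd T.Poset n k) s ↔
            ((s : ℂ) = prodDistinctEigenvalues (GradedPoset.DUAdd T.Poset n k) ∨
              (s : ℂ) = -prodDistinctEigenvalues (GradedPoset.DUAdd T.Poset n k)))) ∧
    ((∀ n : ℕ, 2 ≤ n → GradedPoset.rankSize (YoungPower r) (n - 1) < GradedPoset.rankSize (YoungPower r) n) ∧
      ∀ (n : ℕ) (k : ℤ),
        ((GradedPoset.DUAdd (YoungPower r) n k).det = 0 →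
          ∀ s : ℤ, IsLastSmithInvariant (GradedPoset.DUAdd (YoungPower r) n k) s ↔ s = 0) ∧
        ((GradedPoset.DUAdd (YoungPower r) n k).det ≠ 0 →
          ∀ s : ℤ, IsLastSmithInvariant (GradedPoset.DUAdd (YoungPower r) n k) s ↔
            ((s : ℂ) = prodDistinctEigenvalues (GradedPoset.DUAdd (YoungPower r) n k) ∨
              (s : ℂ) = -prodDistinctEigenvalues (GradedPoset.DUAdd (YoungPower r) n k)))) := by
  exact ⟨fun _ hT => GradedPoset.rankSize_lt_and_isLastSmithInvariant_iff _ hr hT.isDifferentialSystem,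
    GradedPoset.rankSize_lt_and_isLastSmithInvariant_iff _ hr
      (YoungPower.isDifferentialSystem r)⟩
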